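/- A Durfee symbol $[d\mid\bar d]=[d_1,\dots,d_k\mid\bar d_1,\dots,\bar d_{\bar k}]$ is a pair of finite weakly decreasing sequences of non-negative integers (trailing zeros allowed). Put $n_j=d_j+k-j\ge 0$ $(1\le j\le k)$ and $-\bar n_j-1=\bar d_j+\bar k-j\ge 0$ $(1\le j\le\bar k)$; its Maya diagram has as filled boxes the $n_j$ together with all negative integers other than the $\bar n_j$. Two symbols are in the same shape class if their Maya diagrams are translates of each other. For a second symbol $[\delta\mid\bar\delta]=[\delta_1,\dots,\delta_\kappa\mid\bar\delta_1,\dots,\bar\delta_{\bar\kappa}]$ put likewise $l_j=\delta_j+\kappa-j$ and $-\bar l_j-1=\bar\delta_j+\bar\kappa-j$. Let $P_n^{(\alpha,\beta)}(z)=\frac1{n!}\sum_{s=0}^n\binom ns(n+\alpha+\beta+1)_{\overline s}\,(\alpha+s+1)_{\overline{n-s}}\left(\frac{z-1}2\right)^s$ be the Jacobi polynomial with real parameters ($P_n=0$ for $n<0$), where $(x)_{\overline m}=x(x+1)\cdots(x+m-1)$ and $(x)_{\underline m}=x(x-1)\cdots(x-m+1)$. With $M=k+\bar k+\kappa+\bar\kappa$,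 the Jacobi pseudo-Wronskian $P^{[d\mid\bar d]\otimes[\delta\mid\bar\delta]}(z;\alpha,\beta)$ is the determinant of size $M$ whose columns are, in this order, the vectors ($1\le i\le M$) $$\mathcal P^{(j)}_i=\frac{(n_j+\alpha+\beta+1)_{\overline{i-1}}}{2^{i-1}}P^{(\alpha+i-1,\beta+i-1)}_{n_j-i+1}(z)\quad(1\le j\le k),$$ $$\overline{\mathcal P}^{(j)}_i=(-2)^{i-1}(-\bar n_j)_{\overline{i-1}}(1-z^2)^{M-i}P^{(-\alpha-i+1,-\beta-i+1)}_{-\bar n_j+i-2}(z)\quad(1\le j\le \bar k),$$ $$\Pi^{(j)}_i=(-1)^{i-1}(l_j-\alpha)_{\underline{i-1}}(1-z)^{M-i}P^{(-\alpha-i+1,\beta+i-1)}_{l_j}(z)\quad(1\le j\le \kappa),$$ $$\overline\Pi^{(j)}_i=(-\bar l_j-1-\beta)_{\underline{i-1}}(1+z)^{M-i}P^{(\alpha+i-1,-\beta-i+1)}_{-\bar l_j-1}(z)\quad(1\le j\le \bar\kappa).$$ **Theorem.** Let $[d\mid\bar d]$ and $[\delta\mid\bar\delta]$ be Durfee symbols,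 and let $\lambda,\mu$ be partitions (trailing zeros allowed), of lengths $l(\lambda)$, $l(\mu)$, such that $[\lambda\mid\varnothing]$ is in the shape class of $[d\mid\bar d]$ and $[\mu\mid\varnothing]$ in that of $[\delta\mid\bar\delta]$. Define $\bar d_1,\bar\delta_1\in\mathbb Z$ in the formulas below by $l(\lambda)=\bar d_1+k$ and $l(\mu)=\bar\delta_1+\kappa$; if $\bar k>0$ and $\lambda$ has no zero part, this $\bar d_1$ is the first entry of $\bar d$, and if $\bar\kappa>0$ and $\mu$ has no zero part, this $\bar\delta_1$ is the first entry of $\bar\delta$. For real $\alpha,\beta$ and $z\neq1$ let $$R(z;\alpha,\beta)=(1-z)^{(\bar k+\kappa)(\bar k+\kappa-1)-(\bar\delta_1+\kappa)(\bar\delta_1+\kappa-1)}(1+z)^{(\bar k+\bar\kappa)(\bar k+\bar\kappa-1)}\,P^{[\lambda\mid\varnothing]\otimes[\mu\mid\varnothing]}\bigl(z;\ \alpha-(\bar d_1+\bar k)+\bar\delta_1+\bar\kappa,\ \beta-(\bar d_1+\bar k+\bar\delta_1+\bar\kappa)\bigr).$$ 1. If none of $\alpha,\beta,\alpha+\beta,\alpha-\beta$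 is an integer, there is a constant $c\ne0$, independent of $z$, with $P^{[d\mid\bar d]\otimes[\delta\mid\bar\delta]}(z;\alpha,\beta)=c\,R(z;\alpha,\beta)$ for all real $z\ne1$. 2. For all real $\alpha,\beta$ the two sides are linearly dependent: there are constants $a,b$, not both zero and independent of $z$, with $a\,P^{[d\mid\bar d]\otimes[\delta\mid\bar\delta]}(z;\alpha,\beta)=b\,R(z;\alpha,\beta)$ for all real $z\neq1$. -/

import Mathlib

open Polynomial

noncomputable section

/-- A (generalized) Durfee symbol `[d₁,…,d_k ∣ d̄₁,…,d̄_k̄]`: two weakly decreasing finite sequences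
of natural numbers (trailing zeros allowed). Indices are `0`-based: `d j` is `d_{j+1}`. -/
structure DurfeeSymbol where
  k : ℕ
  kbar : ℕ
  d : Fin k → ℕ
  dbar : Fin kbar → ℕ
  antitone_d : Antitone d
  antitone_dbar : Antitone dbar

namespace DurfeeSymbol

/-- The symbol `[λ ∣ ∅]`. -/
def ofPartition {p : ℕ} (lam : Fin p → ℕ) (h : Antitone lam) : DurfeeSymbol where
  k := p
  kbar := 0
  d := lam
  dbar := Fin.elim0
  antitone_d := h
  antitone_dbar := fun i => i.elim0

/-- The nonnegative spectral index `n_j = d_j + k - j` (with `j` counted from `1`). -/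
def idx (D : DurfeeSymbol) (j : Fin D.k) : ℕ := D.d j + (D.k - (j + 1))

/-- The natural number `-n̄_j - 1 = d̄_j + k̄ - j` (with `j` counted from `1`). -/
def idxBar (D : DurfeeSymbol) (j : Fin D.kbar) : ℕ := D.dbar j + (D.kbar - (j + 1))

/-- The filled boxes of the Maya diagram `(n₁,…,n_k, n̄_k̄,…,n̄₁)` of a Durfee symbol: the `n_j`,
together with all negative integers other than the `n̄_j`. -/
def maya (D : DurfeeSymbol) : Set ℤ :=
  {m | (∃ j, m = (D.idx j : ℤ)) ∨ (m < 0 ∧ ∀ j, m ≠ -(D.idxBar j : ℤ) - 1)}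

/-- Two symbols are in the same shape class (same Young diagram, origin forgotten): their Maya
diagrams differ by a displacement of the origin. -/
def SameShapeClass (D E : DurfeeSymbol) : Prop :=
  ∃ s : ℤ, E.maya = (fun m => m + s) '' D.maya

end DurfeeSymbol

/-- The Jacobi polynomial `P_n^{(α,β)}` for arbitrary real parameters,
`(1/n!) ∑ₛ C(n,s) (n+α+β+1)(n+α+β+2)⋯(n+α+β+s) (α+s+1)⋯(α+n) ((z-1)/2)^s`. -/
def jacobiP (n : ℕ) (α β : ℝ) : ℝ[X] :=
  ∑ s ∈ Finset.range (n + 1),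
    C ((n.choose s : ℝ) * (ascPochhammer ℝ s).eval ((n : ℝ) + α + β + 1)
        * (ascPochhammer ℝ (n - s)).eval (α + (s : ℝ) + 1) / (n.factorial : ℝ))
      * (C (1 / 2) * (X - 1)) ^ s

/-- Entry in row `i` (counted from `0`) of the column of the seed function `ψ_n`, `n ≥ 0`;
Jacobi polynomials of negative degree are zero. -/
def jacobiEntry (α β : ℝ) (n i : ℕ) : ℝ[X] :=
  if i ≤ n then
    C ((ascPochhammer ℝ i).eval ((n : ℝ) + α + β + 1) / 2 ^ i)
      * jacobiP (n - i) (α + (i : ℝ)) (β + (i : ℝ))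
  else 0

/-- Entry in row `i` (from `0`) of the column of `ψ_{-n-1}`, `n ≥ 0`, in a determinant
of size `M`. -/
def jacobiEntryBar (M : ℕ) (α β : ℝ) (n i : ℕ) : ℝ[X] :=
  C ((-2) ^ i * (ascPochhammer ℝ i).eval ((n : ℝ) + 1)) * (1 - X ^ 2) ^ (M - (i + 1))
    * jacobiP (n + i) (-α - (i : ℝ)) (-β - (i : ℝ))

/-- Entry in row `i` (from `0`) of the column of `φ_l`, `l ≥ 0`, in a determinant of size `M`. -/
def jacobiShadowEntry (M : ℕ) (α β : ℝ) (l i : ℕ) : ℝ[X] :=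
  C ((-1) ^ i * (descPochhammer ℝ i).eval ((l : ℝ) - α)) * (1 - X) ^ (M - (i + 1))
    * jacobiP l (-α - (i : ℝ)) (β + (i : ℝ))

/-- Entry in row `i` (from `0`) of the column of `φ_{-l-1}`, `l ≥ 0`, in a determinant
of size `M`. -/
def jacobiShadowEntryBar (M : ℕ) (α β : ℝ) (l i : ℕ) : ℝ[X] :=
  C ((descPochhammer ℝ i).eval ((l : ℝ) - β)) * (1 + X) ^ (M - (i + 1))
    * jacobiP l (α + (i : ℝ)) (-β - (i : ℝ))

/-- The Jacobi pseudo-Wronskian `P^{[d∣d̄]⊗[δ∣δ̄]}(z; α, β)`: a determinant of size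
`M = k + k̄ + κ + κ̄` whose columns are, in this order, those of the four families of seeds. -/
def jacobiPseudoWronskian (D Δ : DurfeeSymbol) (α β : ℝ) : ℝ[X] :=
  let M := D.k + D.kbar + Δ.k + Δ.kbar
  let column : Fin M → ℕ → ℝ[X] :=
    Fin.append
      (Fin.append
        (Fin.append (fun j => jacobiEntry α β (D.idx j))
          (fun j => jacobiEntryBar M α β (D.idxBar j)))
        (fun j => jacobiShadowEntry M α β (Δ.idx j)))
      (fun j => jacobiShadowEntryBar M α β (Δ.idxBar j))
  Matrix.det (Matrix.of fun i j : Fin M => column j (i : ℕ))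

/-- The pair of parameters is nondegenerate: none of `α`, `β`, `α + β`, `α - β` is an integer. -/
def JacobiNondegenerate (α β : ℝ) : Prop :=
  ∀ m : ℤ, α ≠ (m : ℝ) ∧ β ≠ (m : ℝ) ∧ α + β ≠ (m : ℝ) ∧ α - β ≠ (m : ℝ)

/-- The right-hand side of the equivalence relation (without the constant factor), for the canonical
representative `[λ ∣ ∅] ⊗ [μ ∣ ∅]`. -/
def jacobiCanonicalSide (D Δ : DurfeeSymbol) {p q : ℕ} (lam : Fin p → ℕ) (hlam : Antitone lam)
    (mu : Fin q → ℕ) (hmu : Antitone mu) (d₁ δ₁ : ℤ) (α β z : ℝ) : ℝ :=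
  (1 - z) ^ (((D.kbar : ℤ) + Δ.k) * ((D.kbar : ℤ) + Δ.k - 1)
      - (δ₁ + (Δ.k : ℤ)) * (δ₁ + (Δ.k : ℤ) - 1))
    * (1 + z) ^ (((D.kbar : ℤ) + Δ.kbar) * ((D.kbar : ℤ) + Δ.kbar - 1))
    * (jacobiPseudoWronskian (DurfeeSymbol.ofPartition lam hlam) (DurfeeSymbol.ofPartition mu hmu)
        (α + ((-(d₁ + (D.kbar : ℤ)) + δ₁ + (Δ.kbar : ℤ) : ℤ) : ℝ))
        (β + ((-(d₁ + (D.kbar : ℤ) + δ₁ + (Δ.kbar : ℤ)) : ℤ) : ℝ))).eval z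

end

/-!
On `(-1, 1)` the pseudo-Wronskian of a pair of Durfee symbols is, up to explicit powers of `1 - z`
and `1 + z`, the ordinary Wronskian of seed functions `ψ_n`, `φ_l` (`n, l ∈ ℤ`):
`(1 - z) ^ (-xα) (1 + z) ^ (-yβ)` times a Jacobi polynomial, with `x, y ∈ {0, 1}` depending on the
family and on the sign of the index. This holds because differentiation maps each seed function to
a multiple of a seed function of the same type with parameters `α + 1, β + 1` (`Seed.poly_succ`,
`Seed.iteratedDeriv_deriv`, `eval_seedDet_eq_wronskian`).

Multiplying all seed functions by one function `g` multiplies their Wronskian by a power of `g`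
(`det_iteratedDeriv_mul`). For `g = (1 - z) ^ α` the family of seeds is mapped to itself with the
roles of `ψ` and `φ` exchanged and `α` replaced by `-α` (`gaugeEquiv_swap`); for
`g = (1 - z) ^ α (1 + z) ^ β` the indices are reversed, `n ↦ -n - 1`, and both parameters change
sign (`gaugeEquiv_conj`). In both cases the pseudo-Wronskian divided by
`(1 - z) ^ (a (a - 1)) (1 + z) ^ (b (b - 1))`, where `a` and `b` count the seeds with `x = 1` and
`y = 1`, does not change. `GaugeEquiv` is equality of these quotients up to a nonzero constant.

If the seed `ψ₀ = 1` is present, expanding the determinant along its column leaves the Wronskian of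
the derivatives of the other seeds: the first Maya diagram is translated by one
(`gaugeEquiv_insert`). For generic parameters the constants that appear do not vanish. A Maya
diagram is recorded by its finite symmetric difference with the negative integers. Translating it
by one either adds the index `0` or removes the index `-1`; the former is the removal of `ψ₀` read
backwards and the latter is its image under the reversal of indices
(`gaugeEquiv_translate_left`). The exchange of the two families gives the translations of the second
diagram. Hence translates of the two diagrams give proportional quotients, and the displacements are
determined by the charge (`IsIndexSet.charge_eq`), which yields the shifts of the parameters.

For arbitrary parameters, proportionality of two functions is the vanishing of their
`2 × 2` minors. These are continuous in the parameters and vanish on a dense set.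
-/

/-! ### Derivatives of Jacobi polynomials -/

/-- The coefficient of `((z - 1) / 2) ^ s` in `P_n^{(a,b)}(z)`. -/
noncomputable def jacobiCoeff (n : ℕ) (a b : ℝ) (s : ℕ) : ℝ :=
  (n.choose s : ℝ) * (ascPochhammer ℝ s).eval ((n : ℝ) + a + b + 1)
    * (ascPochhammer ℝ (n - s)).eval (a + (s : ℝ) + 1) / (n.factorial : ℝ)

/-- The Jacobi polynomial in the variable `u = (z - 1) / 2`. -/
noncomputable def jacobiU (n : ℕ) (a b : ℝ) : ℝ[X] :=
  ∑ s ∈ Finset.range (n + 1), C (jacobiCoeff n a b s) * X ^ s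

theorem jacobiP_eq_comp (n : ℕ) (a b : ℝ) :
    jacobiP n a b = (jacobiU n a b).comp (C (1 / 2) * (X - 1)) := by
  simp [jacobiP, jacobiU, jacobiCoeff, comp, eval₂_finsetSum]

theorem jacobiCoeff_of_lt {n s : ℕ} (h : n < s) (a b : ℝ) : jacobiCoeff n a b s = 0 := by
  simp [jacobiCoeff, Nat.choose_eq_zero_of_lt h]

theorem coeff_jacobiU (n : ℕ) (a b : ℝ) (s : ℕ) :
    (jacobiU n a b).coeff s = jacobiCoeff n a b s := by
  simp only [jacobiU, finsetSum_coeff, coeff_C_mul, coeff_X_pow, mul_ite, mul_one, mul_zero,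
    Finset.sum_ite_eq, Finset.mem_range]
  split_ifs with h
  · rfl
  · exact (jacobiCoeff_of_lt (by omega) a b).symm

theorem jacobiCoeff_add (s r : ℕ) (a b : ℝ) :
    jacobiCoeff (s + r) a b s = (ascPochhammer ℝ s).eval ((s : ℝ) + r + a + b + 1)
      * (ascPochhammer ℝ r).eval (a + (s : ℝ) + 1) / (s.factorial * r.factorial) := by
  have h : ((s + r).choose s : ℝ) * (s.factorial * r.factorial) = (s + r).factorial := by
    have := Nat.choose_mul_factorial_mul_factorial (Nat.le_add_right s r)
    rw [Nat.add_sub_cancel_left] at this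
    rw [← this]; push_cast; ring
  have h1 : (s.factorial : ℝ) ≠ 0 := by positivity
  have h2 : (r.factorial : ℝ) ≠ 0 := by positivity
  have h3 : ((s + r).factorial : ℝ) ≠ 0 := by positivity
  rw [jacobiCoeff, Nat.add_sub_cancel_left, div_eq_div_iff h3 (by positivity), ← h]
  push_cast
  ring

theorem ascPochhammer_eval_succ_left (n : ℕ) (x : ℝ) :
    (ascPochhammer ℝ (n + 1)).eval x = x * (ascPochhammer ℝ n).eval (x + 1) := by
  simp [ascPochhammer_succ_left]

theorem descPochhammer_eval_succ_left (n : ℕ) (x : ℝ) :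
    (descPochhammer ℝ (n + 1)).eval x = x * (descPochhammer ℝ n).eval (x - 1) := by
  simp [descPochhammer_succ_left]

theorem jacobiU_derivative (n : ℕ) (a b : ℝ) :
    derivative (jacobiU (n + 1) a b) = C (n + a + b + 2) * jacobiU n (a + 1) (b + 1) := by
  ext s
  rw [coeff_derivative, coeff_C_mul, coeff_jacobiU, coeff_jacobiU]
  rcases lt_or_ge n s with h | h
  · rw [jacobiCoeff_of_lt h, jacobiCoeff_of_lt (by omega)]; simp
  obtain ⟨r, rfl⟩ := Nat.exists_eq_add_of_le h
  rw [jacobiCoeff_add, show s + r + 1 = (s + 1) + r by ring, jacobiCoeff_add,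
    ascPochhammer_eval_succ_left, Nat.factorial_succ]
  push_cast
  rw [show (s : ℝ) + 1 + r + a + b + 1 + 1 = s + r + (a + 1) + (b + 1) + 1 by ring,
    show a + ((s : ℝ) + 1) + 1 = a + 1 + s + 1 by ring]
  field_simp
  ring

/-- The identity `jacobiP_shadow` in the variable `u`. -/
theorem jacobiU_shadow (n : ℕ) (a b : ℝ) :
    X * derivative (jacobiU n a b) + C a * jacobiU n a b
      = C (n + a) * jacobiU n (a - 1) (b + 1) := by
  ext s
  have key : (s + a) * jacobiCoeff n a b s = (n + a) * jacobiCoeff n (a - 1) (b + 1) s := by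
    rcases lt_or_ge n s with h | h
    · rw [jacobiCoeff_of_lt h, jacobiCoeff_of_lt h]; simp
    obtain ⟨r, rfl⟩ := Nat.exists_eq_add_of_le h
    rw [jacobiCoeff_add, jacobiCoeff_add]
    have h1 := ascPochhammer_eval_succ_left r (a + s)
    rw [ascPochhammer_succ_eval] at h1
    push_cast
    rw [show (s : ℝ) + r + (a - 1) + (b + 1) + 1 = s + r + a + b + 1 by ring,
      show a - 1 + (s : ℝ) + 1 = a + s by ring]
    linear_combination (-(ascPochhammer ℝ s).eval ((s : ℝ) + r + a + b + 1)
      / (s.factorial * r.factorial)) * h1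
  rw [coeff_add, coeff_C_mul, coeff_C_mul, coeff_jacobiU, coeff_jacobiU, ← key]
  cases s with
  | zero => simp
  | succ s =>
    rw [coeff_X_mul, coeff_derivative, coeff_jacobiU]
    push_cast
    ring

/-- The identity `jacobiP_shadowBar` in the variable `u`. -/
theorem jacobiU_shadowBar (n : ℕ) (a b : ℝ) :
    (X + 1) * derivative (jacobiU n a b) + C b * jacobiU n a b
      = C (n + b) * jacobiU n (a + 1) (b - 1) := by
  ext s
  have key : (s + b) * jacobiCoeff n a b s + (s + 1) * jacobiCoeff n a b (s + 1)
      = (n + b) * jacobiCoeff n (a + 1) (b - 1) s := by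
    rcases lt_or_ge n s with h | h
    · rw [jacobiCoeff_of_lt h, jacobiCoeff_of_lt h, jacobiCoeff_of_lt (by omega)]; simp
    obtain ⟨r, rfl⟩ := Nat.exists_eq_add_of_le h
    cases r with
    | zero =>
      rw [jacobiCoeff_of_lt (s := s + 1) (by omega), jacobiCoeff_add, jacobiCoeff_add]
      simp only [ascPochhammer_zero, eval_one]
      push_cast
      rw [show (s : ℝ) + 0 + (a + 1) + (b - 1) + 1 = s + 0 + a + b + 1 by ring]
      ring
    | succ r =>
      rw [jacobiCoeff_add, jacobiCoeff_add, show s + (r + 1) = (s + 1) + r by ring,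
        jacobiCoeff_add, ascPochhammer_eval_succ_left r, ascPochhammer_succ_eval,
        ascPochhammer_succ_eval, Nat.factorial_succ, Nat.factorial_succ]
      push_cast
      rw [show (s : ℝ) + (r + 1) + (a + 1) + (b - 1) + 1 = s + r + a + b + 2 by ring,
        show (s : ℝ) + 1 + r + a + b + 1 = s + r + a + b + 2 by ring,
        show (s : ℝ) + (r + 1) + a + b + 1 = s + r + a + b + 2 by ring,
        show a + 1 + (s : ℝ) + 1 = a + s + 2 by ring,
        show a + ((s : ℝ) + 1) + 1 = a + s + 2 by ring,
        show a + (s : ℝ) + 1 + 1 = a + s + 2 by ring]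
      field_simp
      ring
  rw [add_mul, one_mul, coeff_add, coeff_add, coeff_C_mul, coeff_C_mul, coeff_jacobiU,
    coeff_jacobiU, coeff_derivative, coeff_jacobiU, ← key]
  cases s with
  | zero => simp; ring
  | succ s =>
    rw [coeff_X_mul, coeff_derivative, coeff_jacobiU]
    push_cast
    ring

/-- The identity `jacobiP_bar` in the variable `u`. -/
theorem jacobiU_bar (n : ℕ) (a b : ℝ) :
    X * (X + 1) * derivative (jacobiU n a b) + (C b * X + C a * (X + 1)) * jacobiU n a b
      = C ((n : ℝ) + 1) * jacobiU (n + 1) (a - 1) (b - 1) := by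
  have key (s : ℕ) : (s + a + b) * jacobiCoeff n a b s + (s + 1 + a) * jacobiCoeff n a b (s + 1)
      = (n + 1) * jacobiCoeff (n + 1) (a - 1) (b - 1) (s + 1) := by
    rcases lt_or_ge n s with h | h
    · rw [jacobiCoeff_of_lt h, jacobiCoeff_of_lt (by omega), jacobiCoeff_of_lt (by omega)]; simp
    obtain ⟨r, rfl⟩ := Nat.exists_eq_add_of_le h
    cases r with
    | zero =>
      rw [jacobiCoeff_of_lt (s := s + 1) (by omega), jacobiCoeff_add,
        show s + 0 + 1 = (s + 1) + 0 by ring, jacobiCoeff_add, ascPochhammer_eval_succ_left,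
        Nat.factorial_succ]
      simp only [ascPochhammer_zero, eval_one]
      push_cast
      rw [show (s : ℝ) + 1 + 0 + (a - 1) + (b - 1) + 1 + 1 = s + 0 + a + b + 1 by ring]
      field_simp
      ring
    | succ r =>
      rw [jacobiCoeff_add, show s + (r + 1) + 1 = (s + 1) + (r + 1) by ring, jacobiCoeff_add,
        show s + (r + 1) = (s + 1) + r by ring,
        jacobiCoeff_add, ascPochhammer_eval_succ_left r, ascPochhammer_eval_succ_left r,
        ascPochhammer_succ_eval, ascPochhammer_eval_succ_left s, Nat.factorial_succ,
        Nat.factorial_succ]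
      push_cast
      rw [show (s : ℝ) + 1 + (r + 1) + (a - 1) + (b - 1) + 1 + 1 = s + r + a + b + 2 by ring,
        show (s : ℝ) + 1 + r + a + b + 1 = s + r + a + b + 2 by ring,
        show (s : ℝ) + (r + 1) + a + b + 1 = s + r + a + b + 2 by ring,
        show a - 1 + ((s : ℝ) + 1) + 1 + 1 = a + s + 2 by ring,
        show a + ((s : ℝ) + 1) + 1 = a + s + 2 by ring,
        show a + (s : ℝ) + 1 + 1 = a + s + 2 by ring]
      field_simp
      ring
  rw [show X * (X + 1) * derivative (jacobiU n a b) + (C b * X + C a * (X + 1)) * jacobiU n a b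
      = X * (X * derivative (jacobiU n a b) + derivative (jacobiU n a b)
        + C (a + b) * jacobiU n a b) + C a * jacobiU n a b by rw [C_add]; ring]
  ext s
  cases s with
  | zero =>
    have h := jacobiCoeff_add 0 (n + 1) (a - 1) (b - 1)
    have h' := jacobiCoeff_add 0 n a b
    rw [zero_add] at h h'
    simp only [coeff_add, coeff_jacobiU, mul_coeff_zero, coeff_X_zero, coeff_C_zero, zero_mul, h, h']
    rw [ascPochhammer_eval_succ_left, Nat.factorial_succ]
    push_cast
    rw [show a - 1 + (0 : ℝ) + 1 + 1 = a + 0 + 1 by ring]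
    simp only [ascPochhammer_zero, eval_one]
    field_simp
    ring
  | succ s =>
    rw [coeff_add, coeff_X_mul, coeff_add, coeff_add, coeff_C_mul, coeff_C_mul, coeff_C_mul,
      coeff_jacobiU, coeff_jacobiU, coeff_jacobiU, coeff_derivative, coeff_jacobiU, ← key]
    cases s with
    | zero => simp; ring
    | succ s =>
      rw [coeff_X_mul, coeff_derivative, coeff_jacobiU]
      push_cast
      ring

theorem jacobiP_derivative (n : ℕ) (a b : ℝ) :
    derivative (jacobiP (n + 1) a b) = C ((n + a + b + 2) / 2) * jacobiP n (a + 1) (b + 1) := by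
  rw [jacobiP_eq_comp, jacobiP_eq_comp, derivative_comp, jacobiU_derivative, mul_comp, C_comp,
    div_eq_mul_one_div (n + a + b + 2), C_mul (a := n + a + b + 2)]
  simp only [derivative_mul, derivative_C, derivative_sub, derivative_X, derivative_one]
  ring

/-- Up to the factor `(1 - z) ^ (a - 1)`, the derivative of `(1 - z) ^ a P_n^{(a,b)}`. -/
theorem jacobiP_shadow (n : ℕ) (a b : ℝ) :
    (1 - X) * derivative (jacobiP n a b) - C a * jacobiP n a b
      = -C (n + a) * jacobiP n (a - 1) (b + 1) := by
  have h := congrArg (fun p : ℝ[X] => p.comp (C (1 / 2) * (X - 1))) (jacobiU_shadow n a b)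
  simp only [add_comp, mul_comp, X_comp, C_comp] at h
  rw [jacobiP_eq_comp, jacobiP_eq_comp, derivative_comp]
  simp only [derivative_mul, derivative_C, derivative_sub, derivative_X, derivative_one]
  linear_combination -h

/-- Up to the factor `(1 + z) ^ (b - 1)`, the derivative of `(1 + z) ^ b P_n^{(a,b)}`. -/
theorem jacobiP_shadowBar (n : ℕ) (a b : ℝ) :
    (1 + X) * derivative (jacobiP n a b) + C b * jacobiP n a b
      = C (n + b) * jacobiP n (a + 1) (b - 1) := by
  have h := congrArg (fun p : ℝ[X] => p.comp (C (1 / 2) * (X - 1))) (jacobiU_shadowBar n a b)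
  simp only [add_comp, mul_comp, X_comp, C_comp, one_comp] at h
  have h2 : (C (1 / 2) : ℝ[X]) * 2 = 1 := by
    rw [show (2 : ℝ[X]) = C 2 from rfl, ← C_mul]; norm_num
  rw [jacobiP_eq_comp, jacobiP_eq_comp, derivative_comp]
  simp only [derivative_mul, derivative_C, derivative_sub, derivative_X, derivative_one]
  linear_combination h +
    (derivative (jacobiU n a b)).comp (C (1 / 2) * (X - 1)) * h2

/-- Up to the factor `(1 - z) ^ (a - 1) * (1 + z) ^ (b - 1)`, the derivative of
`(1 - z) ^ a * (1 + z) ^ b * P_n^{(a,b)}`. -/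
theorem jacobiP_bar (n : ℕ) (a b : ℝ) :
    (1 - X ^ 2) * derivative (jacobiP n a b) + (C b * (1 - X) - C a * (1 + X)) * jacobiP n a b
      = -C (2 * ((n : ℝ) + 1)) * jacobiP (n + 1) (a - 1) (b - 1) := by
  have h := congrArg (fun p : ℝ[X] => p.comp (C (1 / 2) * (X - 1))) (jacobiU_bar n a b)
  simp only [add_comp, mul_comp, X_comp, C_comp, one_comp] at h
  have h2 : (C (1 / 2) : ℝ[X]) * 2 = 1 := by
    rw [show (2 : ℝ[X]) = C 2 from rfl, ← C_mul]; norm_num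
  rw [jacobiP_eq_comp, jacobiP_eq_comp, derivative_comp, C_mul, show (C 2 : ℝ[X]) = 2 from rfl]
  simp only [derivative_mul, derivative_C, derivative_sub, derivative_X, derivative_one]
  generalize (derivative (jacobiU n a b)).comp (C (1 / 2) * (X - 1)) = P at *
  generalize (jacobiU n a b).comp (C (1 / 2) * (X - 1)) = Q at *
  generalize (C (1 / 2) : ℝ[X]) = t at *
  linear_combination (-2) * h + (P * t * (X - 1) ^ 2 + (X - 1) * (P + C b * Q + C a * Q)
    - P * (X - 1) ) * h2

/-! ### Seed functions and the columns of the determinant -/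

/-- A seed: `inl n` stands for `ψ_n` and `inr l` for `φ_l`, with `n` and `l` arbitrary integers. -/
abbrev Seed := ℤ ⊕ ℤ

namespace Seed

/-- `1` if the seed function carries the factor `(1 - z) ^ (-α)`, `0` otherwise. -/
def xWeight : Seed → ℕ
  | .inl (.ofNat _) => 0
  | .inl (.negSucc _) => 1
  | .inr (.ofNat _) => 1
  | .inr (.negSucc _) => 0

/-- `1` if the seed function carries the factor `(1 + z) ^ (-β)`, `0` otherwise. -/
def yWeight : Seed → ℕ
  | .inl (.ofNat _) => 0
  | .inl (.negSucc _) => 1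
  | .inr (.ofNat _) => 0
  | .inr (.negSucc _) => 1

/-- The polynomial part of the `i`-th derivative of a seed function. -/
noncomputable def poly (α β : ℝ) : Seed → ℕ → ℝ[X]
  | .inl (.ofNat n) => jacobiEntry α β n
  | .inl (.negSucc n) => fun i => C ((-2) ^ i * (ascPochhammer ℝ i).eval ((n : ℝ) + 1))
      * jacobiP (n + i) (-α - (i : ℝ)) (-β - (i : ℝ))
  | .inr (.ofNat l) => fun i => C ((-1) ^ i * (descPochhammer ℝ i).eval ((l : ℝ) - α))
      * jacobiP l (-α - (i : ℝ)) (β + (i : ℝ))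
  | .inr (.negSucc l) => fun i => C ((descPochhammer ℝ i).eval ((l : ℝ) - β))
      * jacobiP l (α + (i : ℝ)) (-β - (i : ℝ))

/-- The column of a seed in a determinant of size `M`. -/
noncomputable def column (M : ℕ) (α β : ℝ) : Seed → ℕ → ℝ[X]
  | .inl (.ofNat n) => jacobiEntry α β n
  | .inl (.negSucc n) => jacobiEntryBar M α β n
  | .inr (.ofNat l) => jacobiShadowEntry M α β l
  | .inr (.negSucc l) => jacobiShadowEntryBar M α β l

theorem column_eq (M : ℕ) (α β : ℝ) (s : Seed) (i : ℕ) :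
    s.column M α β i = (1 - X) ^ (s.xWeight * (M - (i + 1)))
      * (1 + X) ^ (s.yWeight * (M - (i + 1))) * s.poly α β i := by
  rcases s with (n | n) | (n | n)
  · simp [column, xWeight, yWeight, poly]
  · simp only [column, xWeight, yWeight, poly, jacobiEntryBar, one_mul]
    rw [← mul_pow, show (1 - X) * (1 + X) = (1 - X ^ 2 : ℝ[X]) by ring]
    ring
  · simp only [column, xWeight, yWeight, poly, jacobiShadowEntry, one_mul, zero_mul, pow_zero]
    ring
  · simp only [column, xWeight, yWeight, poly, jacobiShadowEntryBar, one_mul, zero_mul, pow_zero]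
    ring

theorem derivative_jacobiEntry (α β : ℝ) (n i : ℕ) :
    derivative (jacobiEntry α β n i) = jacobiEntry α β n (i + 1) := by
  rcases lt_trichotomy n i with h | rfl | h
  · rw [jacobiEntry, jacobiEntry, if_neg (by omega), if_neg (by omega), derivative_zero]
  · simp [jacobiEntry, jacobiP]
  · obtain ⟨r, rfl⟩ := Nat.exists_eq_add_of_lt h
    rw [jacobiEntry, jacobiEntry, if_pos (by omega), if_pos (by omega),
      show i + r + 1 - i = r + 1 by omega, show i + r + 1 - (i + 1) = r by omega,
      derivative_C_mul, jacobiP_derivative, ← mul_assoc, ← C_mul, ascPochhammer_succ_eval]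
    congr 2
    · push_cast
      field_simp
      ring
    · push_cast; ring
    · push_cast; ring

/-- The recurrence satisfied by the polynomial parts of the successive derivatives of
`(1 - z) ^ (-α) (1 + z) ^ (-β) h(z)`, with the first or second factor absent if the weight is `0`. -/
theorem poly_succ (α β : ℝ) (s : Seed) (i : ℕ) :
    (1 - X) ^ s.xWeight * (1 + X) ^ s.yWeight * derivative (s.poly α β i)
      + (C (s.xWeight * (α + i)) * (1 + X) ^ s.yWeight
        - C (s.yWeight * (β + i)) * (1 - X) ^ s.xWeight) * s.poly α β i
      = s.poly α β (i + 1) := by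
  rcases s with (n | n) | (n | n)
  · simp [xWeight, yWeight, poly, derivative_jacobiEntry]
  · have h := jacobiP_bar (n + i) (-α - i) (-β - i)
    simp only [xWeight, yWeight, poly, derivative_C_mul, pow_one, ascPochhammer_succ_eval]
    push_cast at h ⊢
    rw [show -α - ((i : ℝ) + 1) = -α - i - 1 by ring, show -β - ((i : ℝ) + 1) = -β - i - 1 by ring,
      ← add_assoc n i 1]
    simp only [C_mul, C_add, C_sub, C_neg, C_1, pow_succ] at h ⊢
    linear_combination (C ((-2) ^ i) * C ((ascPochhammer ℝ i).eval ((n : ℝ) + 1))) * h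
  · have h := jacobiP_shadow n (-α - i) (β + i)
    simp only [xWeight, yWeight, poly, derivative_C_mul, pow_one, descPochhammer_succ_eval]
    push_cast at h ⊢
    rw [show -α - ((i : ℝ) + 1) = -α - i - 1 by ring, ← add_assoc β]
    simp only [C_mul, C_add, C_sub, C_neg, C_1, C_0, pow_succ, pow_zero] at h ⊢
    linear_combination (C ((-1) ^ i) * C ((descPochhammer ℝ i).eval ((n : ℝ) - α))) * h
  · have h := jacobiP_shadowBar n (α + i) (-β - i)
    simp only [xWeight, yWeight, poly, derivative_C_mul, pow_one, descPochhammer_succ_eval]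
    push_cast at h ⊢
    rw [show -β - ((i : ℝ) + 1) = -β - i - 1 by ring, ← add_assoc α]
    simp only [C_mul, C_add, C_sub, C_neg, C_1, C_0, pow_zero] at h ⊢
    linear_combination (C ((descPochhammer ℝ i).eval ((n : ℝ) - β))) * h

/-- The `i`-th derivative of a seed function on the interval `(-1, 1)`; see
`Seed.iteratedDeriv_deriv`. -/
noncomputable def deriv (α β : ℝ) (s : Seed) (i : ℕ) (z : ℝ) : ℝ :=
  (1 - z) ^ (-(s.xWeight * (α + i))) * (1 + z) ^ (-(s.yWeight * (β + i)))
    * (s.poly α β i).eval z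

theorem hasDerivAt_deriv (α β : ℝ) (s : Seed) (i : ℕ) {z : ℝ} (hz : z ∈ Set.Ioo (-1 : ℝ) 1) :
    HasDerivAt (s.deriv α β i) (s.deriv α β (i + 1) z) z := by
  have hx : 0 < 1 - z := by linarith [hz.2]
  have hy : 0 < 1 + z := by linarith [hz.1]
  have h1 : HasDerivAt (fun z : ℝ => 1 - z) (-1) z := by
    simpa using (hasDerivAt_id z).const_sub 1
  have h2 : HasDerivAt (fun z : ℝ => 1 + z) 1 z := by
    simpa using (hasDerivAt_id z).const_add 1
  have h := ((h1.rpow_const (p := -(s.xWeight * (α + i))) (Or.inl hx.ne')).mul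
    (h2.rpow_const (p := -(s.yWeight * (β + i))) (Or.inl hy.ne'))).mul
    ((s.poly α β i).hasDerivAt z)
  refine h.congr_deriv ?_
  have hpow (w : ℕ) (t u : ℝ) (hu : 0 < u) :
      u ^ (-(w * (t + ((i + 1 : ℕ) : ℝ)))) = u ^ (-(w * (t + i))) / u ^ w := by
    rw [← Real.rpow_natCast u w, ← Real.rpow_sub hu]
    congr 1
    push_cast
    ring
  rw [deriv, hpow _ _ _ hx, hpow _ _ _ hy, ← poly_succ, Real.rpow_sub_one hx.ne',
    Real.rpow_sub_one hy.ne']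
  have hw : (s.xWeight = 0 ∨ s.xWeight = 1) ∧ (s.yWeight = 0 ∨ s.yWeight = 1) := by
    rcases s with (n | n) | (n | n) <;> simp [xWeight, yWeight]
  obtain ⟨hX | hX, hY | hY⟩ := hw <;>
  · simp only [hX, hY, Pi.mul_apply, eval_add, eval_sub, eval_mul, eval_one, eval_X, eval_C,
      pow_zero, pow_one, Nat.cast_zero, Nat.cast_one]
    field_simp
    ring

theorem iteratedDeriv_deriv (α β : ℝ) (s : Seed) (i : ℕ) {z : ℝ}
    (hz : z ∈ Set.Ioo (-1 : ℝ) 1) : iteratedDeriv i (s.deriv α β 0) z = s.deriv α β i z := by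
  induction i generalizing z with
  | zero => simp
  | succ i ih =>
    rw [iteratedDeriv_succ, ← (hasDerivAt_deriv α β s i hz).deriv]
    apply Filter.EventuallyEq.deriv_eq
    filter_upwards [isOpen_Ioo.mem_nhds hz] with y hy using ih hy

theorem contDiffAt_deriv (α β : ℝ) (s : Seed) (i : ℕ) {n : WithTop ℕ∞} {z : ℝ}
    (hz : z ∈ Set.Ioo (-1 : ℝ) 1) : ContDiffAt ℝ n (s.deriv α β i) z := by
  have hx : 1 - z ≠ 0 := by linarith [hz.2]
  have hy : 1 + z ≠ 0 := by linarith [hz.1]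
  have hp : ContDiffAt ℝ n (fun z => (s.poly α β i).eval z) z :=
    by simpa using (Polynomial.contDiff_aeval (𝕜 := ℝ) (s.poly α β i) n).contDiffAt
  exact (((contDiffAt_const.sub contDiffAt_id).rpow_const_of_ne hx).mul
    ((contDiffAt_const.add contDiffAt_id).rpow_const_of_ne hy)).mul hp

theorem eval_column (M : ℕ) (α β : ℝ) (s : Seed) {i : ℕ} (hi : i < M) {z : ℝ}
    (hz : z ∈ Set.Ioo (-1 : ℝ) 1) :
    (s.column M α β i).eval z = (1 - z) ^ (s.xWeight * (α + (M - 1)))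
      * (1 + z) ^ (s.yWeight * (β + (M - 1))) * iteratedDeriv i (s.deriv α β 0) z := by
  have hx : 0 < 1 - z := by linarith [hz.2]
  have hy : 0 < 1 + z := by linarith [hz.1]
  have hpow (w : ℕ) (t u : ℝ) (hu : 0 < u) :
      u ^ (w * (M - (i + 1))) = u ^ (w * (t + (M - 1))) * u ^ (-(w * (t + i))) := by
    rw [← Real.rpow_natCast, ← Real.rpow_add hu]
    congr 1
    push_cast [Nat.cast_sub (show i + 1 ≤ M from hi)]
    ring
  rw [iteratedDeriv_deriv α β s i hz, column_eq, deriv]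
  simp only [eval_mul, eval_pow, eval_sub, eval_add, eval_one, eval_X]
  rw [hpow _ α _ hx, hpow _ β _ hy]
  ring

end Seed

/-! ### Wronskians -/

/-- Multiplying all the functions by `g` multiplies their Wronskian by `g ^ M`: by the Leibniz
rule the new Wronskian matrix is the old one times a lower triangular matrix with diagonal `g`. -/
theorem det_iteratedDeriv_mul {M : ℕ} (f : Fin M → ℝ → ℝ) (g : ℝ → ℝ) (z : ℝ)
    (hf : ∀ j, ContDiffAt ℝ M (f j) z) (hg : ContDiffAt ℝ M g z) :
    (Matrix.of fun i j : Fin M => iteratedDeriv (i : ℕ) (f j * g) z).det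
      = g z ^ M * (Matrix.of fun i j : Fin M => iteratedDeriv (i : ℕ) (f j) z).det := by
  -- Entry `(i, m)` is the coefficient of the `m`-th derivative of `f j` in the `i`-th of `f j * g`.
  let T : Matrix (Fin M) (Fin M) ℝ := Matrix.of fun i m =>
    if (m : ℕ) ≤ i then ((i : ℕ).choose m : ℝ) * iteratedDeriv ((i : ℕ) - m) g z else 0
  have hT : T.det = g z ^ M := by
    rw [Matrix.det_of_isLowerTriangular]
    · simp [T]
    · intro i j hij
      have hij' : (i : ℕ) < j := hij
      simp only [T, Matrix.of_apply]
      rw [if_neg (by omega)]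
  rw [← hT, ← Matrix.det_mul]
  congr 1
  ext i j
  have hle : ((i : ℕ) : WithTop ℕ∞) ≤ (M : WithTop ℕ∞) := by exact_mod_cast i.2.le
  rw [Matrix.of_apply, iteratedDeriv_mul ((hf j).of_le hle) (hg.of_le hle), Matrix.mul_apply]
  simp only [T, Matrix.of_apply, ite_mul, zero_mul]
  rw [Fin.sum_univ_eq_sum_range (fun m => if m ≤ (i : ℕ) then
    ((i : ℕ).choose m : ℝ) * iteratedDeriv ((i : ℕ) - m) g z * iteratedDeriv m (f j) z else 0) M,
    ← Finset.sum_filter]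
  refine Finset.sum_congr ?_ fun m _ => by ring
  ext m
  simp only [Finset.mem_range, Finset.mem_filter]
  omega

/-- The pseudo-Wronskian of a finite sequence of seeds. -/
noncomputable def seedDet {M : ℕ} (s : Fin M → Seed) (α β : ℝ) : ℝ[X] :=
  (Matrix.of fun i j : Fin M => (s j).column M α β (i : ℕ)).det

theorem eval_seedDet {M : ℕ} (s : Fin M → Seed) (α β z : ℝ) :
    (seedDet s α β).eval z
      = (Matrix.of fun i j : Fin M => ((s j).column M α β (i : ℕ)).eval z).det := by
  rw [seedDet, ← Polynomial.coe_evalRingHom, RingHom.map_det]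
  rfl

/-- On `(-1, 1)` the pseudo-Wronskian is the Wronskian of the seed functions times powers of
`1 - z` and `1 + z`. -/
theorem eval_seedDet_eq_wronskian {M : ℕ} (s : Fin M → Seed) (α β : ℝ) {z : ℝ}
    (hz : z ∈ Set.Ioo (-1 : ℝ) 1) :
    (seedDet s α β).eval z = (1 - z) ^ ((∑ j, (s j).xWeight : ℕ) * (α + (M - 1)))
      * (1 + z) ^ ((∑ j, (s j).yWeight : ℕ) * (β + (M - 1)))
      * (Matrix.of fun i j : Fin M => iteratedDeriv (i : ℕ) ((s j).deriv α β 0) z).det := by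
  have hx : 0 < 1 - z := by linarith [hz.2]
  have hy : 0 < 1 + z := by linarith [hz.1]
  rw [eval_seedDet]
  have h : (Matrix.of fun i j : Fin M => ((s j).column M α β (i : ℕ)).eval z)
      = Matrix.of fun i j : Fin M => ((1 - z) ^ ((s j).xWeight * (α + (M - 1)))
        * (1 + z) ^ ((s j).yWeight * (β + (M - 1)))) *
        (Matrix.of fun i j : Fin M => iteratedDeriv (i : ℕ) ((s j).deriv α β 0) z) i j := by
    ext i j
    exact (s j).eval_column M α β i.2 hz
  rw [h, Matrix.det_mul_row, Finset.prod_mul_distrib, ← Real.rpow_sum_of_pos hx,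
    ← Real.rpow_sum_of_pos hy, Nat.cast_sum, Nat.cast_sum, Finset.sum_mul, Finset.sum_mul]

/-- If the seed functions of `s'` with parameters `α', β'` are those of `s` with parameters
`α, β`, all multiplied by `(1 - z) ^ A (1 + z) ^ B`, then the two pseudo-Wronskians differ only by
powers of `1 - z` and `1 + z`. -/
theorem seedDet_gauge {M : ℕ} {s s' : Fin M → Seed} {α β α' β' : ℝ} (A B : ℝ)
    (hpoly : ∀ j, (s' j).poly α' β' 0 = (s j).poly α β 0)
    (hA : ∀ j, (s' j).xWeight * α' = (s j).xWeight * α - A)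
    (hB : ∀ j, (s' j).yWeight * β' = (s j).yWeight * β - B) :
    (1 - X) ^ ((∑ j, (s j).xWeight) * (M - 1)) * (1 + X) ^ ((∑ j, (s j).yWeight) * (M - 1))
        * seedDet s' α' β'
      = (1 - X) ^ ((∑ j, (s' j).xWeight) * (M - 1)) * (1 + X) ^ ((∑ j, (s' j).yWeight) * (M - 1))
        * seedDet s α β := by
  rcases Nat.eq_zero_or_pos M with rfl | hM
  · simp [seedDet]
  apply Polynomial.eq_of_infinite_eval_eq
  refine (Set.Ioo_infinite (show (-1 : ℝ) < 1 by norm_num)).mono fun z hz => ?_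
  have hx : 0 < 1 - z := by linarith [hz.2]
  have hy : 0 < 1 + z := by linarith [hz.1]
  let g : ℝ → ℝ := fun y => (1 - y) ^ A * (1 + y) ^ B
  have hg : ContDiffAt ℝ M g z :=
    ((contDiffAt_const.sub contDiffAt_id).rpow_const_of_ne hx.ne').mul
      ((contDiffAt_const.add contDiffAt_id).rpow_const_of_ne hy.ne')
  have hfun (j : Fin M) : ∀ y ∈ Set.Ioo (-1 : ℝ) 1,
      (s' j).deriv α' β' 0 y = ((s j).deriv α β 0 * g) y := by
    intro y hy
    have hx' : 0 < 1 - y := by linarith [hy.2]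
    have hy' : 0 < 1 + y := by linarith [hy.1]
    have e1 : -((s' j).xWeight * (α' + ((0 : ℕ) : ℝ)))
        = -((s j).xWeight * (α + ((0 : ℕ) : ℝ))) + A := by
      push_cast; linarith [hA j]
    have e2 : -((s' j).yWeight * (β' + ((0 : ℕ) : ℝ)))
        = -((s j).yWeight * (β + ((0 : ℕ) : ℝ))) + B := by
      push_cast; linarith [hB j]
    simp only [Seed.deriv, Pi.mul_apply, g]
    rw [hpoly, e1, e2, Real.rpow_add hx', Real.rpow_add hy']
    ring
  have hder (i : ℕ) (j : Fin M) : iteratedDeriv i ((s' j).deriv α' β' 0) z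
      = iteratedDeriv i ((s j).deriv α β 0 * g) z := by
    apply Filter.EventuallyEq.iteratedDeriv_eq
    filter_upwards [isOpen_Ioo.mem_nhds hz] with y hy using hfun j y hy
  have hW := det_iteratedDeriv_mul (fun j => (s j).deriv α β 0) g z
    (fun j => (s j).contDiffAt_deriv α β 0 hz) hg
  -- Summed over the columns, `hA` and `hB` make the powers with real exponents cancel.
  have hsum (w w' : Fin M → ℕ) (t t' E : ℝ) (h : ∀ j, w' j * t' = w j * t - E) :
      ((∑ j, w' j : ℕ) : ℝ) * t' = (∑ j, w j : ℕ) * t - M * E := by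
    push_cast
    rw [Finset.sum_mul, Finset.sum_mul, Finset.sum_congr rfl fun j _ => h j,
      Finset.sum_sub_distrib]
    simp
  have hpow (w w' : ℕ) (t t' E u : ℝ) (hu : 0 < u) (h : (w' : ℝ) * t' = w * t - M * E) :
      u ^ (w * (M - 1)) * (u ^ (w' * (t' + (M - 1))) * (u ^ E) ^ M)
        = u ^ (w' * (M - 1)) * u ^ (w * (t + (M - 1))) := by
    rw [← Real.rpow_mul_natCast hu.le, ← Real.rpow_natCast, ← Real.rpow_natCast,
      ← Real.rpow_add hu, ← Real.rpow_add hu, ← Real.rpow_add hu]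
    congr 1
    push_cast [Nat.cast_sub (show 1 ≤ M from hM)]
    linear_combination h
  have h1 := hpow _ _ _ _ A (1 - z) hx (hsum _ _ _ _ A hA)
  have h2 := hpow _ _ _ _ B (1 + z) hy (hsum _ _ _ _ B hB)
  simp only [Set.mem_ofPred_eq, eval_mul, eval_pow, eval_sub, eval_add, eval_one, eval_X]
  rw [eval_seedDet_eq_wronskian s α β hz, eval_seedDet_eq_wronskian s' α' β' hz]
  simp only [hder]
  rw [hW]
  simp only [g, mul_pow]
  generalize (Matrix.of fun i j : Fin M => iteratedDeriv (i : ℕ) ((s j).deriv α β 0) z).det = W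
  calc _ = ((1 - z) ^ ((∑ j, (s j).xWeight) * (M - 1)) *
        ((1 - z) ^ ((∑ j, (s' j).xWeight : ℕ) * (α' + (M - 1))) * ((1 - z) ^ A) ^ M)) *
        ((1 + z) ^ ((∑ j, (s j).yWeight) * (M - 1)) *
        ((1 + z) ^ ((∑ j, (s' j).yWeight : ℕ) * (β' + (M - 1))) * ((1 + z) ^ B) ^ M)) * W := by
        ring
    _ = _ := by rw [h1, h2]; ring

/-! ### Pseudo-Wronskians of finite sets of seeds -/

/-- The pseudo-Wronskian of a finite set of seeds, for an arbitrary enumeration of the set: the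
order of the columns affects only the sign. -/
noncomputable def setDet (K : Finset Seed) (α β : ℝ) : ℝ[X] :=
  seedDet (fun j => (K.equivFin.symm j : Seed)) α β

theorem seedDet_eq_setDet {M : ℕ} {s : Fin M → Seed} (hs : Function.Injective s)
    {K : Finset Seed} (hK : Finset.univ.image s = K) (α β : ℝ) :
    ∃ ε : ℝ, ε ≠ 0 ∧ seedDet s α β = C ε * setDet K α β := by
  have hM : K.card = M := by
    rw [← hK, Finset.card_image_of_injective _ hs, Finset.card_univ, Fintype.card_fin]
  subst hM
  have hmem (j) : s j ∈ K := hK ▸ Finset.mem_image_of_mem s (Finset.mem_univ j)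
  have hσ : Function.Injective fun j => K.equivFin ⟨s j, hmem j⟩ := by
    intro i j h
    exact hs (congrArg Subtype.val (K.equivFin.injective h))
  let σ : Equiv.Perm (Fin K.card) := Equiv.ofBijective _ (Finite.injective_iff_bijective.mp hσ)
  have hsσ (j) : s j = (K.equivFin.symm (σ j) : Seed) := by
    simp [σ]
  have h : seedDet s α β = ((Matrix.of fun i j : Fin K.card =>
      (K.equivFin.symm j : Seed).column K.card α β (i : ℕ)).submatrix id σ).det := by
    rw [seedDet]
    congr 1
    ext i j : 2
    rw [Matrix.of_apply, hsσ]
    rfl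
  refine ⟨((Equiv.Perm.sign σ : ℤ) : ℝ), ?_, ?_⟩
  · exact_mod_cast (Equiv.Perm.sign σ).ne_zero
  · rw [h, Matrix.det_permute', setDet, seedDet]
    simp

/-- The number of seeds in `K` carrying a power of `1 - z`. -/
def xCount (K : Finset Seed) : ℕ := ∑ s ∈ K, s.xWeight

/-- The number of seeds in `K` carrying a power of `1 + z`. -/
def yCount (K : Finset Seed) : ℕ := ∑ s ∈ K, s.yWeight

theorem sum_enum (K : Finset Seed) (w : Seed → ℕ) :
    ∑ j, w (K.equivFin.symm j : Seed) = ∑ s ∈ K, w s := by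
  rw [K.equivFin.symm.sum_comp (fun x : K => w x), Finset.sum_coe_sort K w]

/-- The power of `1 - z` (or `1 + z`) by which a pseudo-Wronskian with `n` seeds of positive
`x`-weight (or `y`-weight) is divided; for `n = 0` it is `0`. -/
def gaugeExponent (n : ℕ) : ℕ := n * (n - 1)

/-- The polynomial by which the pseudo-Wronskian of `K` is divided to obtain a quantity invariant
under `gaugeEquiv_swap` and `gaugeEquiv_conj`. -/
noncomputable def gaugeFactor (K : Finset Seed) : ℝ[X] :=
  (1 - X) ^ gaugeExponent (xCount K) * (1 + X) ^ gaugeExponent (yCount K)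

theorem one_sub_X_ne_zero : (1 - X : ℝ[X]) ≠ 0 := by
  intro h
  simpa using congrArg (eval 0) h

theorem one_add_X_ne_zero : (1 + X : ℝ[X]) ≠ 0 := by
  intro h
  simpa using congrArg (eval 0) h

theorem gaugeFactor_ne_zero (K : Finset Seed) : gaugeFactor K ≠ 0 :=
  mul_ne_zero (pow_ne_zero _ one_sub_X_ne_zero) (pow_ne_zero _ one_add_X_ne_zero)

/-- The quotients `setDet / gaugeFactor` of two sets of seeds are equal up to a nonzero constant,
written without division. -/
def GaugeEquiv (K : Finset Seed) (α β : ℝ) (K' : Finset Seed) (α' β' : ℝ) : Prop :=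
  ∃ c : ℝ, c ≠ 0 ∧
    gaugeFactor K' * setDet K α β = C c * (gaugeFactor K * setDet K' α' β')

namespace GaugeEquiv

variable {K K' K'' : Finset Seed} {α β α' β' α'' β'' : ℝ}

theorem refl (K : Finset Seed) (α β : ℝ) : GaugeEquiv K α β K α β := ⟨1, one_ne_zero, by simp⟩

theorem symm (h : GaugeEquiv K α β K' α' β') : GaugeEquiv K' α' β' K α β := by
  obtain ⟨c, hc, h⟩ := h
  refine ⟨c⁻¹, inv_ne_zero hc, ?_⟩
  rw [h, ← mul_assoc, ← C_mul, inv_mul_cancel₀ hc, C_1, one_mul]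

theorem trans (h : GaugeEquiv K α β K' α' β') (h' : GaugeEquiv K' α' β' K'' α'' β'') :
    GaugeEquiv K α β K'' α'' β'' := by
  obtain ⟨c, hc, h⟩ := h
  obtain ⟨c', hc', h'⟩ := h'
  refine ⟨c * c', mul_ne_zero hc hc', mul_left_cancel₀ (gaugeFactor_ne_zero K') ?_⟩
  rw [C_mul]
  linear_combination gaugeFactor K'' * h + C c * gaugeFactor K * h'

end GaugeEquiv

/-- Flipping all weights, or keeping them all, relates the power of `1 ∓ z` produced by
`seedDet_gauge` to `gaugeExponent`. -/
theorem gaugeExponent_add {a a' M : ℕ} (h : a' = a ∨ a + a' = M) :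
    a * (M - 1) + gaugeExponent a' = a' * (M - 1) + gaugeExponent a := by
  rcases h with rfl | rfl
  · rfl
  · have key (u v : ℕ) : u * (u + v - 1) = gaugeExponent u + u * v := by
      rcases u with _ | u
      · simp [gaugeExponent]
      · simp only [gaugeExponent, Nat.add_sub_cancel, show u + 1 + v - 1 = u + v by omega]
        ring
    rw [key, add_comm a a', key]
    ring

/-- A map of seeds which multiplies all seed functions by `(1 - z) ^ A (1 + z) ^ B`, up to the change
of parameters, and flips all the weights or none, preserves `setDet / gaugeFactor`. -/
theorem gaugeEquiv_of_gauge {K : Finset Seed} {α β α' β' : ℝ} (f : Seed → Seed)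
    (hf : Function.Injective f) (A B : ℝ)
    (hpoly : ∀ s, (f s).poly α' β' 0 = s.poly α β 0)
    (hA : ∀ s, (f s).xWeight * α' = s.xWeight * α - A)
    (hB : ∀ s, (f s).yWeight * β' = s.yWeight * β - B)
    (hx : (∀ s, (f s).xWeight = s.xWeight) ∨ ∀ s, s.xWeight + (f s).xWeight = 1)
    (hy : (∀ s, (f s).yWeight = s.yWeight) ∨ ∀ s, s.yWeight + (f s).yWeight = 1) :
    GaugeEquiv K α β (K.image f) α' β' := by
  obtain ⟨ε, hε, hdet⟩ := seedDet_eq_setDet (s := fun j => f (K.equivFin.symm j : Seed))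
    (K := K.image f) (hf.comp (Subtype.val_injective.comp K.equivFin.symm.injective)) (by
      ext t
      simp only [Finset.mem_image, Finset.mem_univ, true_and]
      constructor
      · rintro ⟨j, rfl⟩
        exact ⟨_, (K.equivFin.symm j).2, rfl⟩
      · rintro ⟨s, hs, rfl⟩
        exact ⟨K.equivFin ⟨s, hs⟩, by simp⟩) α' β'
  have h := seedDet_gauge (s := fun j => (K.equivFin.symm j : Seed))
    (s' := fun j => f (K.equivFin.symm j : Seed)) A B (fun j => hpoly _) (fun j => hA _)
    (fun j => hB _)
  have hsum (w : Seed → ℕ) (hw : (∀ s, w (f s) = w s) ∨ ∀ s, w s + w (f s) = 1) :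
      ∑ s ∈ K.image f, w s = ∑ s ∈ K, w s ∨
        ∑ s ∈ K, w s + ∑ s ∈ K.image f, w s = K.card := by
    rw [Finset.sum_image fun _ _ _ _ h => hf h]
    rcases hw with hw | hw
    · exact .inl (Finset.sum_congr rfl fun s _ => hw s)
    · right
      rw [← Finset.sum_add_distrib, Finset.sum_congr rfl fun s _ => hw s]
      simp
  have ex := gaugeExponent_add (hsum _ hx)
  have ey := gaugeExponent_add (hsum _ hy)
  rw [hdet, sum_enum K Seed.xWeight, sum_enum K Seed.yWeight,
    sum_enum K (fun s => (f s).xWeight), sum_enum K (fun s => (f s).yWeight),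
    ← Finset.sum_image (s := K) (g := f) (f := Seed.xWeight) (fun _ _ _ _ h => hf h),
    ← Finset.sum_image (s := K) (g := f) (f := Seed.yWeight) (fun _ _ _ _ h => hf h)] at h
  change _ = _ * setDet K α β at h
  refine GaugeEquiv.symm ⟨ε⁻¹, inv_ne_zero hε, ?_⟩
  simp only [gaugeFactor, xCount, yCount]
  generalize ∑ s ∈ K, s.xWeight = a at *
  generalize ∑ s ∈ K, s.yWeight = b at *
  generalize ∑ s ∈ K.image f, s.xWeight = a' at *
  generalize ∑ s ∈ K.image f, s.yWeight = b' at *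
  have hεC : (C ε : ℝ[X]) * C ε⁻¹ = 1 := by rw [← C_mul, mul_inv_cancel₀ hε, C_1]
  have hpx := congrArg (fun n => (1 - X : ℝ[X]) ^ n) ex
  have hpy := congrArg (fun n => (1 + X : ℝ[X]) ^ n) ey
  simp only [pow_add] at hpx hpy
  apply mul_left_cancel₀ (mul_ne_zero (pow_ne_zero (a' * (K.card - 1)) one_sub_X_ne_zero)
    (pow_ne_zero (b' * (K.card - 1)) one_add_X_ne_zero))
  calc _ = ((1 - X) ^ (a' * (K.card - 1)) * (1 - X) ^ gaugeExponent a) *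
        ((1 + X) ^ (b' * (K.card - 1)) * (1 + X) ^ gaugeExponent b) *
        (C ε * C ε⁻¹) * setDet (K.image f) α' β' := by rw [hεC]; ring
    _ = C ε⁻¹ * ((1 - X) ^ gaugeExponent a' * (1 + X) ^ gaugeExponent b') *
        ((1 - X) ^ (a * (K.card - 1)) * (1 + X) ^ (b * (K.card - 1)) *
          (C ε * setDet (K.image f) α' β')) := by rw [← hpx, ← hpy]; ring
    _ = _ := by rw [h]; ring

/-! ### The symmetries -/

namespace Seed

/-- Reversal of the indices, `n ↦ -n - 1`, of both families. -/
def conj : Seed → Seed := Sum.map (fun n => -1 - n) (fun n => -1 - n)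

theorem conj_conj (s : Seed) : s.conj.conj = s := by
  rcases s with n | n <;> simp [conj]

/-- Translation by one of the indices of the first family. -/
def up : Seed → Seed := Sum.map (fun n => n + 1) id

theorem up_injective : Function.Injective up :=
  (add_left_injective (1 : ℤ)).sumMap Function.injective_id

end Seed

theorem jacobiEntry_zero (α β : ℝ) (n : ℕ) : jacobiEntry α β n 0 = jacobiP n α β := by
  simp [jacobiEntry]

/-- Division of all seed functions by `(1 - z) ^ (-α)` exchanges the two families. -/
theorem gaugeEquiv_swap (K : Finset Seed) (α β : ℝ) :
    GaugeEquiv K α β (K.image Sum.swap) (-α) β := by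
  apply gaugeEquiv_of_gauge Sum.swap Sum.swap_leftInverse.injective α 0
  · rintro ((n | n) | (n | n)) <;> simp [Seed.poly, jacobiEntry_zero]
  · rintro ((n | n) | (n | n)) <;> simp [Seed.xWeight]
  · rintro ((n | n) | (n | n)) <;> simp [Seed.yWeight]
  · right
    rintro ((n | n) | (n | n)) <;> simp [Seed.xWeight]
  · left
    rintro ((n | n) | (n | n)) <;> simp [Seed.yWeight]

/-- Division of all seed functions by `(1 - z) ^ (-α) (1 + z) ^ (-β)` reverses the indices. -/
theorem gaugeEquiv_conj (K : Finset Seed) (α β : ℝ) :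
    GaugeEquiv K α β (K.image Seed.conj) (-α) (-β) := by
  have h1 (n : ℕ) : -1 - Int.ofNat n = Int.negSucc n := by
    rw [Int.negSucc_eq, Int.ofNat_eq_natCast]; ring
  have h2 (n : ℕ) : -1 - Int.negSucc n = Int.ofNat n := by
    rw [Int.negSucc_eq, Int.ofNat_eq_natCast]; ring
  apply gaugeEquiv_of_gauge Seed.conj (Function.LeftInverse.injective Seed.conj_conj) α β
  · rintro ((n | n) | (n | n)) <;>
      simp only [Seed.conj, Sum.map_inl, Sum.map_inr, h1, h2] <;>
      simp [Seed.poly, jacobiEntry_zero]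
  · rintro ((n | n) | (n | n)) <;>
      simp only [Seed.conj, Sum.map_inl, Sum.map_inr, h1, h2] <;> simp [Seed.xWeight]
  · rintro ((n | n) | (n | n)) <;>
      simp only [Seed.conj, Sum.map_inl, Sum.map_inr, h1, h2] <;> simp [Seed.yWeight]
  · right
    rintro ((n | n) | (n | n)) <;>
      simp only [Seed.conj, Sum.map_inl, Sum.map_inr, h1, h2] <;> simp [Seed.xWeight]
  · right
    rintro ((n | n) | (n | n)) <;>
      simp only [Seed.conj, Sum.map_inl, Sum.map_inr, h1, h2] <;> simp [Seed.yWeight]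

/-! ### Removal of the constant seed -/

theorem JacobiNondegenerate.add_int {α β : ℝ} (h : JacobiNondegenerate α β) (m n : ℤ) :
    JacobiNondegenerate (α + m) (β + n) := by
  intro k
  obtain ⟨h1, -⟩ := h (k - m)
  obtain ⟨-, h2, -⟩ := h (k - n)
  obtain ⟨-, -, h3, -⟩ := h (k - m - n)
  obtain ⟨-, -, -, h4⟩ := h (k - m + n)
  push_cast at h1 h2 h3 h4
  exact ⟨fun e => h1 (by linarith), fun e => h2 (by linarith), fun e => h3 (by linarith),
    fun e => h4 (by linarith)⟩

theorem JacobiNondegenerate.neg_left {α β : ℝ} (h : JacobiNondegenerate α β) :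
    JacobiNondegenerate (-α) β := by
  intro k
  obtain ⟨h1, -, h3, h4⟩ := h (-k)
  obtain ⟨-, h2, -⟩ := h k
  push_cast at h1 h3 h4
  exact ⟨fun e => h1 (by linarith), h2, fun e => h4 (by linarith), fun e => h3 (by linarith)⟩

theorem JacobiNondegenerate.neg {α β : ℝ} (h : JacobiNondegenerate α β) :
    JacobiNondegenerate (-α) (-β) := by
  intro k
  obtain ⟨h1, h2, h3, h4⟩ := h (-k)
  push_cast at h1 h2 h3 h4
  exact ⟨fun e => h1 (by linarith), fun e => h2 (by linarith), fun e => h3 (by linarith),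
    fun e => h4 (by linarith)⟩

namespace Seed

theorem xWeight_up {s : Seed} (hs : s ≠ .inl (-1)) : s.up.xWeight = s.xWeight := by
  rcases s with (n | n | n) | n
  · rfl
  · exact absurd rfl hs
  · rfl
  · rfl

theorem yWeight_up {s : Seed} (hs : s ≠ .inl (-1)) : s.up.yWeight = s.yWeight := by
  rcases s with (n | n | n) | n
  · rfl
  · exact absurd rfl hs
  · rfl
  · rfl

/-- Differentiation maps seed functions to multiples of seed functions: the first family is
translated by one and the parameters `α, β` increase by one. -/
theorem column_up_succ {α β : ℝ} (h : JacobiNondegenerate α β) (M : ℕ) {s : Seed}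
    (hs : s ≠ .inl (-1)) : ∃ c : ℝ, c ≠ 0 ∧ ∀ i,
      s.up.column (M + 1) α β (i + 1) = C c * s.column M (α + 1) (β + 1) i := by
  rcases s with (n | n | n) | (n | n)
  · refine ⟨(n + α + β + 2) / 2, ?_, fun i => ?_⟩
    · obtain ⟨-, -, h3, -⟩ := h (-(n + 2))
      push_cast at h3
      intro e
      exact h3 (by linarith)
    change jacobiEntry α β (n + 1) (i + 1) = _ * jacobiEntry (α + 1) (β + 1) n i
    rw [jacobiEntry, jacobiEntry]
    by_cases hi : i ≤ n
    · rw [if_pos hi, if_pos (by omega), ← mul_assoc, ← C_mul, ascPochhammer_eval_succ_left,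
        Nat.add_sub_add_right]
      push_cast
      rw [show (n : ℝ) + 1 + α + β + 1 + 1 = n + (α + 1) + (β + 1) + 1 by ring,
        show α + ((i : ℝ) + 1) = α + 1 + i by ring, show β + ((i : ℝ) + 1) = β + 1 + i by ring]
      congr 2
      rw [pow_succ]
      field_simp
      ring
    · rw [if_neg hi, if_neg (by omega), mul_zero]
  · exact absurd rfl hs
  · refine ⟨-2 * (n + 1), ?_, fun i => ?_⟩
    · have : (0 : ℝ) < n + 1 := by positivity
      intro e
      linarith
    change jacobiEntryBar (M + 1) α β n (i + 1) = _ * jacobiEntryBar M (α + 1) (β + 1) (n + 1) i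
    rw [jacobiEntryBar, jacobiEntryBar, ascPochhammer_eval_succ_left, Nat.add_sub_add_right,
      show n + (i + 1) = n + 1 + i by ring]
    push_cast
    rw [show -α - ((i : ℝ) + 1) = -(α + 1) - i by ring,
      show -β - ((i : ℝ) + 1) = -(β + 1) - i by ring, pow_succ]
    simp only [C_mul]
    ring
  · refine ⟨-(n - α), ?_, fun i => ?_⟩
    · obtain ⟨h1, -⟩ := h n
      intro e
      exact h1 (by push_cast; linarith)
    change jacobiShadowEntry (M + 1) α β n (i + 1) = _ * jacobiShadowEntry M (α + 1) (β + 1) n i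
    rw [jacobiShadowEntry, jacobiShadowEntry, descPochhammer_eval_succ_left, Nat.add_sub_add_right]
    push_cast
    rw [show -α - ((i : ℝ) + 1) = -(α + 1) - i by ring,
      show β + ((i : ℝ) + 1) = β + 1 + i by ring, show (n : ℝ) - α - 1 = n - (α + 1) by ring,
      pow_succ]
    simp only [C_mul, C_neg, C_1]
    ring
  · refine ⟨n - β, ?_, fun i => ?_⟩
    · obtain ⟨-, h2, -⟩ := h n
      intro e
      exact h2 (by push_cast; linarith)
    change jacobiShadowEntryBar (M + 1) α β n (i + 1)
      = _ * jacobiShadowEntryBar M (α + 1) (β + 1) n i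
    rw [jacobiShadowEntryBar, jacobiShadowEntryBar, descPochhammer_eval_succ_left,
      Nat.add_sub_add_right]
    push_cast
    rw [show -β - ((i : ℝ) + 1) = -(β + 1) - i by ring,
      show α + ((i : ℝ) + 1) = α + 1 + i by ring, show (n : ℝ) - β - 1 = n - (β + 1) by ring]
    simp only [C_mul]
    ring

end Seed

/-- The column of the constant seed `ψ₀ = 1` is the first basis vector, so expanding along it
leaves the pseudo-Wronskian of the derivatives of the remaining seeds. -/
theorem seedDet_cons {α β : ℝ} (h : JacobiNondegenerate α β) {M : ℕ} {s : Fin M → Seed}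
    (hs : ∀ j, s j ≠ .inl (-1)) : ∃ c : ℝ, c ≠ 0 ∧
      seedDet (Fin.cons (.inl 0) fun j => (s j).up : Fin (M + 1) → Seed) α β
        = C c * seedDet s (α + 1) (β + 1) := by
  choose c hc hcol using fun j => Seed.column_up_succ h M (hs j)
  refine ⟨∏ j, c j, Finset.prod_ne_zero_iff.mpr fun j _ => hc j, ?_⟩
  have h0 (i : ℕ) : Seed.column (M + 1) α β (.inl 0) i = if i = 0 then 1 else 0 := by
    change jacobiEntry α β 0 i = _
    rcases i with _ | i <;> simp [jacobiEntry, jacobiP]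
  rw [seedDet, Matrix.det_succ_column_zero, Fin.sum_univ_succ, Finset.sum_eq_zero]
  · simp only [Matrix.of_apply, Fin.cons_zero, h0]
    simp only [Fin.val_zero, pow_zero, if_true, one_mul, add_zero]
    rw [seedDet, map_prod, ← Matrix.det_mul_row]
    congr 1
    ext i j : 2
    simp [hcol]
  · intro i _
    simp [h0]

/-- Removal of the constant seed. The seed `ψ₋₁` is excluded from `K` because its translate would be
`ψ₀` itself. -/
theorem gaugeEquiv_insert {α β : ℝ} (h : JacobiNondegenerate α β) (K : Finset Seed)
    (hK : (.inl (-1) : Seed) ∉ K) :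
    GaugeEquiv (insert (.inl 0) (K.image Seed.up)) α β K (α + 1) (β + 1) := by
  have hne : ∀ s ∈ K, s ≠ .inl (-1) := fun s hs e => hK (e ▸ hs)
  have h0 : (.inl 0 : Seed) ∉ K.image Seed.up := by
    rw [Finset.mem_image]
    rintro ⟨n | n, hn, e⟩
    · simp only [Seed.up, Sum.map_inl, Sum.inl.injEq] at e
      exact hne _ hn (by rw [show n = -1 by omega])
    · simp [Seed.up] at e
  obtain ⟨c, hc, hdet⟩ := seedDet_cons h (s := fun j => (K.equivFin.symm j : Seed))
    fun j => hne _ (K.equivFin.symm j).2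
  have himg : Finset.univ.image (Fin.cons (.inl 0)
      fun j => (K.equivFin.symm j : Seed).up : Fin (K.card + 1) → Seed)
      = insert (.inl 0) (K.image Seed.up) := by
    ext t
    simp only [Finset.mem_image, Finset.mem_univ, true_and, Finset.mem_insert, Fin.exists_fin_succ,
      Fin.cons_zero, Fin.cons_succ]
    refine or_congr eq_comm ⟨?_, ?_⟩
    · rintro ⟨j, rfl⟩
      exact ⟨_, (K.equivFin.symm j).2, rfl⟩
    · rintro ⟨s, hs, rfl⟩
      exact ⟨K.equivFin ⟨s, hs⟩, by simp⟩
  obtain ⟨ε, hε, hε'⟩ := seedDet_eq_setDet (Fin.cons_injective_iff.mpr ⟨by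
      rintro ⟨j, hj⟩
      exact h0 (hj ▸ Finset.mem_image_of_mem _ (K.equivFin.symm j).2),
    Seed.up_injective.comp (Subtype.val_injective.comp K.equivFin.symm.injective)⟩) himg α β
  have hcount (w : Seed → ℕ) (hw0 : w (.inl 0) = 0)
      (hw : ∀ s : Seed, s ≠ .inl (-1) → w s.up = w s) :
      ∑ s ∈ insert (.inl 0) (K.image Seed.up), w s = ∑ s ∈ K, w s := by
    rw [Finset.sum_insert h0, Finset.sum_image fun _ _ _ _ e => Seed.up_injective e, hw0, zero_add]
    exact Finset.sum_congr rfl fun s hs => hw s (hne s hs)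
  have hg : gaugeFactor (insert (.inl 0) (K.image Seed.up)) = gaugeFactor K := by
    simp only [gaugeFactor, xCount, yCount]
    rw [hcount _ rfl fun s => Seed.xWeight_up, hcount _ rfl fun s => Seed.yWeight_up]
  refine ⟨ε⁻¹ * c, mul_ne_zero (inv_ne_zero hε) hc, ?_⟩
  have hεC : (C ε⁻¹ : ℝ[X]) * C ε = 1 := by rw [← C_mul, inv_mul_cancel₀ hε, C_1]
  change _ = C c * setDet K (α + 1) (β + 1) at hdet
  change seedDet (Fin.cons (.inl 0) fun j => (K.equivFin.symm j : Seed).up) α β = _ at hε'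
  rw [hε'] at hdet
  rw [hg, C_mul]
  linear_combination C ε⁻¹ * gaugeFactor K * hdet
    - gaugeFactor K * setDet (insert (.inl 0) (K.image Seed.up)) α β * hεC

/-! ### Translation of Maya diagrams -/

/-- The set of indices of a Maya diagram translated by one: if `F` is the symmetric difference of a
diagram with the negative integers, then so is `translateIndices F` for the translated diagram. -/
def translateIndices (F : Finset ℤ) : Finset ℤ :=
  if -1 ∈ F then (F.image (· + 1)).erase 0 else insert 0 (F.image (· + 1))

theorem mem_translateIndices {F : Finset ℤ} {n : ℤ} :
    n ∈ translateIndices F ↔ if n = 0 then -1 ∉ F else n - 1 ∈ F := by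
  have h : (∃ a ∈ F, a + 1 = n) ↔ n - 1 ∈ F :=
    ⟨fun ⟨a, ha, e⟩ => by rwa [← e, add_sub_cancel_right], fun h => ⟨_, h, by ring⟩⟩
  unfold translateIndices
  split_ifs with h1 h2 h2 <;>
    simp only [Finset.mem_erase, Finset.mem_insert, Finset.mem_image, h] <;> simp_all

theorem mem_image_up_inl {K : Finset Seed} {n : ℤ} :
    (.inl n : Seed) ∈ K.image Seed.up ↔ (.inl (n - 1) : Seed) ∈ K := by
  rw [Finset.mem_image]
  constructor
  · rintro ⟨m | m, hm, e⟩
    · rw [Seed.up, Sum.map_inl, Sum.inl.injEq] at e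
      rwa [← e, add_sub_cancel_right]
    · simp [Seed.up] at e
  · exact fun h => ⟨_, h, by simp [Seed.up]⟩

theorem mem_image_up_inr {K : Finset Seed} {n : ℤ} :
    (.inr n : Seed) ∈ K.image Seed.up ↔ (.inr n : Seed) ∈ K :=
  Seed.up_injective.mem_finset_image (a := .inr n)

theorem mem_image_conj {K : Finset Seed} {s : Seed} : s ∈ K.image Seed.conj ↔ s.conj ∈ K := by
  conv_lhs => rw [← s.conj_conj]
  exact (Function.LeftInverse.injective Seed.conj_conj).mem_finset_image

theorem image_swap_disjSum (F G : Finset ℤ) :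
    (F.disjSum G).image Sum.swap = (G.disjSum F : Finset Seed) := by
  ext s
  conv_lhs => rw [← s.swap_swap]
  rw [Sum.swap_leftInverse.injective.mem_finset_image]
  rcases s with n | n <;> simp

/-- Translating the first Maya diagram by one lowers both parameters by one. If `-1` is not an index
the translated set contains the constant seed, whose removal undoes the translation; otherwise
the same holds after reversal of the indices, with the roles of the two sets exchanged. -/
theorem gaugeEquiv_translate_left {α β : ℝ} (h : JacobiNondegenerate α β) (F G : Finset ℤ) :
    GaugeEquiv (F.disjSum G) α β ((translateIndices F).disjSum G) (α - 1) (β - 1) := by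
  by_cases hF : -1 ∈ F
  · have hK : (F.disjSum G : Finset Seed).image Seed.conj = insert (.inl 0)
        ((((translateIndices F).disjSum G).image Seed.conj).image Seed.up) := by
      ext s
      rcases s with n | n
      · rw [Finset.mem_insert, mem_image_up_inl, mem_image_conj, mem_image_conj]
        simp only [Seed.conj, Sum.map_inl, Finset.inl_mem_disjSum, mem_translateIndices,
          Sum.inl.injEq]
        by_cases hn : n = 0
        · simp [hn, hF]
        · rw [if_neg (by omega), show -1 - (n - 1) - 1 = -1 - n by ring]
          simp [hn]
      · rw [Finset.mem_insert, mem_image_up_inr, mem_image_conj, mem_image_conj]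
        simp [Seed.conj]
    have h1 := gaugeEquiv_conj (F.disjSum G) α β
    rw [hK] at h1
    have h2 := gaugeEquiv_insert h.neg (((translateIndices F).disjSum G).image Seed.conj) (by
      rw [mem_image_conj]
      simp [Seed.conj, mem_translateIndices, hF])
    have h3 := gaugeEquiv_conj ((translateIndices F).disjSum G) (α - 1) (β - 1)
    rw [neg_sub', neg_sub', sub_neg_eq_add, sub_neg_eq_add] at h3
    exact (h1.trans h2).trans h3.symm
  · have hK : ((translateIndices F).disjSum G : Finset Seed)
        = insert (.inl 0) ((F.disjSum G).image Seed.up) := by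
      ext s
      rcases s with n | n
      · rw [Finset.mem_insert, mem_image_up_inl]
        simp only [Finset.inl_mem_disjSum, mem_translateIndices, Sum.inl.injEq]
        by_cases hn : n = 0 <;> simp [hn, hF]
      · rw [Finset.mem_insert, mem_image_up_inr]
        simp
    have h' := h.add_int (-1) (-1)
    have h2 := gaugeEquiv_insert h' (F.disjSum G) (by simpa using hF)
    push_cast at h2
    rw [← hK, neg_add_cancel_right, neg_add_cancel_right] at h2
    exact h2.symm

/-- `F` is the set of indices of the Maya diagram `U`: the filled boxes `n ≥ 0` and the holes
`n < 0`. -/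
def IsIndexSet (F : Finset ℤ) (U : Set ℤ) : Prop := ∀ n, n ∈ F ↔ ¬ (n ∈ U ↔ n < 0)

theorem IsIndexSet.unique {F F' : Finset ℤ} {U : Set ℤ} (h : IsIndexSet F U)
    (h' : IsIndexSet F' U) : F = F' := by
  ext n
  rw [h n, h' n]

theorem IsIndexSet.translate {F : Finset ℤ} {U V : Set ℤ} (h : IsIndexSet F U)
    (hV : ∀ n, n ∈ V ↔ n - 1 ∈ U) : IsIndexSet (translateIndices F) V := by
  intro n
  rw [mem_translateIndices, h, h, hV]
  split_ifs with hn
  · subst hn; simp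
  · rw [show n - 1 < 0 ↔ n < 0 by omega]

theorem IsIndexSet.iterate {F : Finset ℤ} {U : Set ℤ} (h : IsIndexSet F U) (m : ℕ) :
    IsIndexSet (translateIndices^[m] F) {n | n - m ∈ U} := by
  induction m with
  | zero => simpa using h
  | succ m ih =>
    rw [Function.iterate_succ_apply']
    refine ih.translate fun n => ?_
    change n - ((m + 1 : ℕ) : ℤ) ∈ U ↔ n - 1 - (m : ℤ) ∈ U
    rw [Nat.cast_succ, sub_sub, add_comm (1 : ℤ)]

/-- The charge of a Maya diagram: the number of filled boxes `n ≥ 0` minus the number of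
holes `n < 0`. -/
def indexCharge (F : Finset ℤ) : ℤ := ∑ n ∈ F, if n < 0 then -1 else 1

theorem indexCharge_translate (F : Finset ℤ) :
    indexCharge (translateIndices F) = indexCharge F + 1 := by
  have h : ∑ n ∈ F.image (· + 1), (if n < 0 then -1 else 1 : ℤ)
      = indexCharge F + if -1 ∈ F then 2 else 0 := by
    rw [Finset.sum_image fun _ _ _ _ e => add_right_cancel e, indexCharge,
      ← Finset.sum_ite_eq' F (-1) fun _ => (2 : ℤ), ← Finset.sum_add_distrib]
    refine Finset.sum_congr rfl fun n _ => ?_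
    split_ifs <;> omega
  have h0 : 0 ∈ F.image (· + 1) ↔ -1 ∈ F := by
    simp only [Finset.mem_image]
    exact ⟨fun ⟨a, ha, e⟩ => (show a = -1 by omega) ▸ ha, fun h => ⟨-1, h, by norm_num⟩⟩
  rw [translateIndices]
  split_ifs with hF
  · rw [if_pos hF, ← Finset.sum_erase_add _ _ (h0.mpr hF), if_neg (lt_irrefl _)] at h
    rw [indexCharge]
    linarith
  · rw [if_neg hF] at h
    rw [indexCharge, Finset.sum_insert (mt h0.mp hF), h]
    simp [add_comm]

theorem indexCharge_iterate (F : Finset ℤ) (m : ℕ) :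
    indexCharge (translateIndices^[m] F) = indexCharge F + m := by
  induction m with
  | zero => simp
  | succ m ih =>
    rw [Function.iterate_succ_apply', indexCharge_translate, ih]
    push_cast
    ring

theorem gaugeEquiv_iterate_left {α β : ℝ} (h : JacobiNondegenerate α β) (F G : Finset ℤ) (m : ℕ) :
    GaugeEquiv (F.disjSum G) α β ((translateIndices^[m] F).disjSum G) (α - m) (β - m) := by
  induction m with
  | zero => simpa using GaugeEquiv.refl _ α β
  | succ m ih =>
    rw [Function.iterate_succ_apply']
    have h' := h.add_int (-m) (-m)
    push_cast at h'
    rw [← sub_eq_add_neg, ← sub_eq_add_neg] at h'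
    have h2 := ih.trans (gaugeEquiv_translate_left h' _ G)
    push_cast
    rwa [← sub_sub, ← sub_sub]

theorem IsIndexSet.eq_iterate {F F' : Finset ℤ} {U V : Set ℤ} (hF : IsIndexSet F U)
    (hF' : IsIndexSet F' V) {s : ℤ} (hV : V = (fun n => n + s) '' U) :
    (∃ m : ℕ, s = m ∧ F' = translateIndices^[m] F) ∨
      ∃ m : ℕ, s = -m ∧ F = translateIndices^[m] F' := by
  have hmem (n : ℤ) : n ∈ V ↔ n - s ∈ U := by
    rw [hV]
    exact ⟨fun ⟨a, ha, e⟩ => by rwa [← e, add_sub_cancel_right], fun h => ⟨_, h, by ring⟩⟩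
  obtain ⟨m, rfl | rfl⟩ := s.eq_nat_or_neg
  · refine .inl ⟨m, rfl, hF'.unique ?_⟩
    convert hF.iterate m using 1
    ext n
    exact hmem n
  · refine .inr ⟨m, rfl, hF.unique ?_⟩
    convert hF'.iterate m using 1
    ext n
    rw [Set.mem_ofPred_eq, hmem]
    simp

theorem IsIndexSet.charge_eq {F F' : Finset ℤ} {U V : Set ℤ} (hF : IsIndexSet F U)
    (hF' : IsIndexSet F' V) {s : ℤ} (hV : V = (fun n => n + s) '' U) :
    indexCharge F' = indexCharge F + s := by
  rcases hF.eq_iterate hF' hV with ⟨m, rfl, rfl⟩ | ⟨m, rfl, rfl⟩ <;> rw [indexCharge_iterate]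
  ring

theorem IsIndexSet.gaugeEquiv_left {α β : ℝ} (h : JacobiNondegenerate α β) {F F' : Finset ℤ}
    {U V : Set ℤ} (hF : IsIndexSet F U) (hF' : IsIndexSet F' V) {s : ℤ}
    (hV : V = (fun n => n + s) '' U) (G : Finset ℤ) :
    GaugeEquiv (F.disjSum G) α β (F'.disjSum G) (α - s) (β - s) := by
  rcases hF.eq_iterate hF' hV with ⟨m, rfl, rfl⟩ | ⟨m, rfl, rfl⟩
  · exact_mod_cast gaugeEquiv_iterate_left h F G m
  · have h' := gaugeEquiv_iterate_left (h.add_int m m) F' G m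
    push_cast at h' ⊢
    rw [add_sub_cancel_right, add_sub_cancel_right] at h'
    rw [sub_neg_eq_add, sub_neg_eq_add]
    exact h'.symm

theorem IsIndexSet.gaugeEquiv_right {α β : ℝ} (h : JacobiNondegenerate α β) {G G' : Finset ℤ}
    {U V : Set ℤ} (hG : IsIndexSet G U) (hG' : IsIndexSet G' V) {t : ℤ}
    (hV : V = (fun n => n + t) '' U) (F : Finset ℤ) :
    GaugeEquiv (F.disjSum G) α β (F.disjSum G') (α + t) (β - t) := by
  have h1 := gaugeEquiv_swap (F.disjSum G) α β
  have h2 := hG.gaugeEquiv_left h.neg_left hG' hV F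
  have h3 := gaugeEquiv_swap (G'.disjSum F) (-α - t) (β - t)
  rw [image_swap_disjSum] at h1 h3
  rw [neg_sub, sub_neg_eq_add, add_comm (t : ℝ)] at h3
  exact (h1.trans h2).trans h3

/-! ### Durfee symbols -/

namespace DurfeeSymbol

theorem idx_strictAnti (D : DurfeeSymbol) : StrictAnti D.idx := by
  intro i j hij
  have h1 := D.antitone_d hij.le
  have h2 : (i : ℕ) < j := hij
  have h3 := j.2
  simp only [idx]
  omega

theorem idxBar_strictAnti (D : DurfeeSymbol) : StrictAnti D.idxBar := by
  intro i j hij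
  have h1 := D.antitone_dbar hij.le
  have h2 : (i : ℕ) < j := hij
  have h3 := j.2
  simp only [idxBar]
  omega

/-- The indices `n_j` and `n̄_j` of a Durfee symbol. -/
def indices (D : DurfeeSymbol) : Fin (D.k + D.kbar) → ℤ :=
  Fin.append (fun j => .ofNat (D.idx j)) (fun j => .negSucc (D.idxBar j))

theorem indices_injective (D : DurfeeSymbol) : Function.Injective D.indices := by
  refine Fin.append_injective_iff.mpr ⟨?_, ?_, ?_⟩
  · exact fun i j e => D.idx_strictAnti.injective (Int.ofNat.inj e)
  · exact fun i j e => D.idxBar_strictAnti.injective (Int.negSucc.inj e)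
  · exact fun i j e => by cases e

/-- The set of indices of a Durfee symbol. -/
def indexSet (D : DurfeeSymbol) : Finset ℤ := Finset.univ.image D.indices

theorem mem_indexSet (D : DurfeeSymbol) (n : ℤ) :
    n ∈ D.indexSet ↔ (∃ j, n = D.idx j) ∨ ∃ j, n = -(D.idxBar j : ℤ) - 1 := by
  simp only [indexSet, Finset.mem_image, Finset.mem_univ, true_and]
  constructor
  · rintro ⟨j, rfl⟩
    refine Fin.addCases (fun j => ?_) (fun j => ?_) j
    · exact .inl ⟨j, by simp [indices]⟩
    · exact .inr ⟨j, by rw [indices, Fin.append_right, Int.negSucc_eq]; ring⟩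
  · rintro (⟨j, rfl⟩ | ⟨j, rfl⟩)
    · exact ⟨Fin.castAdd _ j, by simp [indices]⟩
    · exact ⟨Fin.natAdd _ j, by rw [indices, Fin.append_right, Int.negSucc_eq]; ring⟩

theorem isIndexSet (D : DurfeeSymbol) : IsIndexSet D.indexSet D.maya := by
  intro n
  rw [mem_indexSet]
  change _ ↔ ¬ (((∃ j, n = (D.idx j : ℤ)) ∨ (n < 0 ∧ ∀ j, n ≠ -(D.idxBar j : ℤ) - 1)) ↔ n < 0)
  have h1 : (∃ j, n = (D.idx j : ℤ)) → ¬ n < 0 := by rintro ⟨j, rfl⟩; omega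
  have h2 : (∃ j, n = -(D.idxBar j : ℤ) - 1) → n < 0 := by rintro ⟨j, rfl⟩; omega
  rw [← not_exists]
  tauto

theorem indexCharge_indexSet (D : DurfeeSymbol) : indexCharge D.indexSet = D.k - D.kbar := by
  rw [indexCharge, indexSet, Finset.sum_image fun _ _ _ _ e => D.indices_injective e,
    Fin.sum_univ_add]
  simp [indices, Int.negSucc_lt_zero, sub_eq_add_neg,
    fun n : ℕ => not_lt.mpr (Int.natCast_nonneg n)]

/-- If a partition without zero parts has the shape of `[d ∣ d̄]`, the displacement between the
two Maya diagrams is `d̄₁ + k̄`: it moves the lowest hole to the origin. -/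
theorem displacement_eq {D : DurfeeSymbol} {p : ℕ} {lam : Fin p → ℕ} (hlam : Antitone lam) {s : ℤ}
    (hs : (ofPartition lam hlam).maya = (fun m => m + s) '' D.maya) (h : 0 < D.kbar)
    (hpos : ∀ i, 0 < lam i) : s = D.dbar ⟨0, h⟩ + D.kbar := by
  have hmem (n : ℤ) : n ∈ (ofPartition lam hlam).maya ↔ n - s ∈ D.maya := by
    rw [hs]
    exact ⟨fun ⟨a, ha, e⟩ => by rwa [← e, add_sub_cancel_right], fun h => ⟨_, h, by ring⟩⟩
  have hbar : D.idxBar ⟨0, h⟩ = D.dbar ⟨0, h⟩ + (D.kbar - 1) := rfl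
  have h0 : (0 : ℤ) ∉ (ofPartition lam hlam).maya := by
    rintro (⟨j, hj⟩ | ⟨hj, -⟩)
    · have h1 : (ofPartition lam hlam).idx j = lam j + (p - (j + 1)) := rfl
      have h2 := hpos j
      omega
    · exact lt_irrefl _ hj
  have hneg (n : ℤ) (hn : n < 0) : n ∈ (ofPartition lam hlam).maya :=
    .inr ⟨hn, fun j => j.elim0⟩
  have h1 : -(D.idxBar ⟨0, h⟩ : ℤ) - 1 ∉ D.maya := by
    rintro (⟨j, hj⟩ | ⟨-, hj⟩)
    · omega
    · exact hj _ rfl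
  apply le_antisymm
  · by_contra hlt
    refine h0 ((hmem 0).mpr (.inr ⟨by omega, fun j hj => ?_⟩))
    have h2 := D.idxBar_strictAnti.antitone (show (⟨0, h⟩ : Fin D.kbar) ≤ j from Nat.zero_le _)
    omega
  · by_contra hlt
    refine h1 ?_
    have h2 := (hmem (-(D.idxBar ⟨0, h⟩ : ℤ) - 1 + s)).mp (hneg _ (by omega))
    rwa [add_sub_cancel_right] at h2

end DurfeeSymbol

/-- The seeds of a pair of Durfee symbols, in the order of the columns of the determinant. -/
def symbolSeeds (D Δ : DurfeeSymbol) : Fin (D.k + D.kbar + Δ.k + Δ.kbar) → Seed :=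
  Fin.append
    (Fin.append
      (Fin.append (fun j => .inl (.ofNat (D.idx j))) (fun j => .inl (.negSucc (D.idxBar j))))
      (fun j => .inr (.ofNat (Δ.idx j))))
    (fun j => .inr (.negSucc (Δ.idxBar j)))

theorem apply_fin_append {A B : Type*} {m n : ℕ} (g : A → B) (a : Fin m → A) (b : Fin n → A)
    (j : Fin (m + n)) :
    g (Fin.append a b j) = Fin.append (fun i => g (a i)) (fun i => g (b i)) j := by
  refine Fin.addCases (fun j => ?_) (fun j => ?_) j <;> simp

theorem jacobiPseudoWronskian_eq_seedDet (D Δ : DurfeeSymbol) (α β : ℝ) :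
    jacobiPseudoWronskian D Δ α β = seedDet (symbolSeeds D Δ) α β := by
  rw [jacobiPseudoWronskian, seedDet]
  congr 1
  ext i j : 2
  rw [Matrix.of_apply, Matrix.of_apply, symbolSeeds, apply_fin_append (Seed.column _ α β)]
  simp only [apply_fin_append (Seed.column _ α β)]
  rfl

theorem symbolSeeds_injective (D Δ : DurfeeSymbol) : Function.Injective (symbolSeeds D Δ) := by
  refine Fin.append_injective_iff.mpr ⟨Fin.append_injective_iff.mpr
    ⟨Fin.append_injective_iff.mpr ⟨?_, ?_, ?_⟩, ?_, ?_⟩, ?_, ?_⟩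
  · exact fun i j e => D.idx_strictAnti.injective (Int.ofNat.inj (Sum.inl.inj e))
  · exact fun i j e => D.idxBar_strictAnti.injective (Int.negSucc.inj (Sum.inl.inj e))
  · exact fun i j e => by cases e
  · exact fun i j e => Δ.idx_strictAnti.injective (Int.ofNat.inj (Sum.inr.inj e))
  · exact fun i j => Fin.addCases (fun i => by simp) (fun i => by simp) i
  · exact fun i j e => Δ.idxBar_strictAnti.injective (Int.negSucc.inj (Sum.inr.inj e))
  · exact fun i j => Fin.addCases (fun i => Fin.addCases (fun i => by simp) (fun i => by simp) i)
      (fun i => by simp) i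

theorem image_symbolSeeds (D Δ : DurfeeSymbol) :
    Finset.univ.image (symbolSeeds D Δ) = D.indexSet.disjSum Δ.indexSet := by
  ext s
  simp only [Finset.mem_image, Finset.mem_univ, true_and, Finset.mem_disjSum,
    DurfeeSymbol.indexSet, symbolSeeds, DurfeeSymbol.indices]
  constructor
  · rintro ⟨j, rfl⟩
    refine Fin.addCases (fun j => ?_) (fun j => .inr ⟨_, ⟨Fin.natAdd _ j, rfl⟩, by simp⟩) j
    refine Fin.addCases (fun j => ?_) (fun j => .inr ⟨_, ⟨Fin.castAdd _ j, rfl⟩, by simp⟩) j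
    exact Fin.addCases (fun j => .inl ⟨_, ⟨Fin.castAdd _ j, rfl⟩, by simp⟩)
      (fun j => .inl ⟨_, ⟨Fin.natAdd _ j, rfl⟩, by simp⟩) j
  · rintro (⟨_, ⟨j, rfl⟩, rfl⟩ | ⟨_, ⟨j, rfl⟩, rfl⟩)
    · refine Fin.addCases (fun j => ?_) (fun j => ?_) j
      · exact ⟨Fin.castAdd _ (Fin.castAdd _ (Fin.castAdd _ j)), by simp⟩
      · exact ⟨Fin.castAdd _ (Fin.castAdd _ (Fin.natAdd _ j)), by simp⟩
    · refine Fin.addCases (fun j => ?_) (fun j => ?_) j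
      · exact ⟨Fin.castAdd _ (Fin.natAdd _ j), by simp⟩
      · exact ⟨Fin.natAdd _ j, by simp⟩

theorem xCount_symbol (D Δ : DurfeeSymbol) :
    xCount (D.indexSet.disjSum Δ.indexSet) = D.kbar + Δ.k := by
  rw [xCount, ← image_symbolSeeds,
    Finset.sum_image fun _ _ _ _ e => symbolSeeds_injective D Δ e, Fin.sum_univ_add,
    Fin.sum_univ_add, Fin.sum_univ_add]
  simp only [symbolSeeds, Fin.append_left, Fin.append_right]
  simp [Seed.xWeight]

theorem yCount_symbol (D Δ : DurfeeSymbol) :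
    yCount (D.indexSet.disjSum Δ.indexSet) = D.kbar + Δ.kbar := by
  rw [yCount, ← image_symbolSeeds,
    Finset.sum_image fun _ _ _ _ e => symbolSeeds_injective D Δ e, Fin.sum_univ_add,
    Fin.sum_univ_add, Fin.sum_univ_add]
  simp only [symbolSeeds, Fin.append_left, Fin.append_right]
  simp [Seed.yWeight]

/-! ### The generic case -/

theorem cast_gaugeExponent (n : ℕ) : (gaugeExponent n : ℤ) = (n : ℤ) * ((n : ℤ) - 1) := by
  rcases n with _ | n <;> simp [gaugeExponent]

/-- The displacements `s`, `t` of the two Maya diagrams are `d₁ + k̄` and `δ₁ + κ̄`, by comparison of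
charges. -/
theorem exists_eq_mul_canonicalSide {D Δ : DurfeeSymbol} {p q : ℕ} {lam : Fin p → ℕ}
    (hlam : Antitone lam) {mu : Fin q → ℕ} (hmu : Antitone mu)
    (hD : DurfeeSymbol.SameShapeClass D (DurfeeSymbol.ofPartition lam hlam))
    (hΔ : DurfeeSymbol.SameShapeClass Δ (DurfeeSymbol.ofPartition mu hmu))
    {d₁ δ₁ : ℤ} (hd₁ : (p : ℤ) = d₁ + D.k) (hδ₁ : (q : ℤ) = δ₁ + Δ.k) {α β : ℝ}
    (h : JacobiNondegenerate α β) :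
    ∃ c : ℝ, c ≠ 0 ∧ ∀ z : ℝ, z ≠ 1 → (jacobiPseudoWronskian D Δ α β).eval z
      = c * jacobiCanonicalSide D Δ lam hlam mu hmu d₁ δ₁ α β z := by
  obtain ⟨s, hs⟩ := hD
  obtain ⟨t, ht⟩ := hΔ
  have hs' := D.isIndexSet.charge_eq (DurfeeSymbol.isIndexSet _) hs
  have ht' := Δ.isIndexSet.charge_eq (DurfeeSymbol.isIndexSet _) ht
  rw [DurfeeSymbol.indexCharge_indexSet, DurfeeSymbol.indexCharge_indexSet] at hs' ht'
  change (p : ℤ) - (0 : ℕ) = _ at hs'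
  change (q : ℤ) - (0 : ℕ) = _ at ht'
  push_cast at hs' ht'
  have h1 := D.isIndexSet.gaugeEquiv_left h (DurfeeSymbol.isIndexSet _) hs Δ.indexSet
  have hn := h.add_int (-s) (-s)
  push_cast at hn
  rw [← sub_eq_add_neg, ← sub_eq_add_neg] at hn
  have h2 := Δ.isIndexSet.gaugeEquiv_right hn (DurfeeSymbol.isIndexSet _) ht
    (DurfeeSymbol.ofPartition lam hlam).indexSet
  obtain ⟨c, hc, hdet⟩ := h1.trans h2
  rw [show α - s + t = α + ((-(d₁ + (D.kbar : ℤ)) + δ₁ + (Δ.kbar : ℤ) : ℤ) : ℝ) by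
      rw [show -(d₁ + (D.kbar : ℤ)) + δ₁ + (Δ.kbar : ℤ) = -s + t by linarith]; push_cast; ring,
    show β - s - t = β + ((-(d₁ + (D.kbar : ℤ) + δ₁ + (Δ.kbar : ℤ)) : ℤ) : ℝ) by
      rw [show -(d₁ + (D.kbar : ℤ) + δ₁ + (Δ.kbar : ℤ)) = -s - t by linarith]; push_cast; ring]
    at hdet
  obtain ⟨ε, hε, hW⟩ := seedDet_eq_setDet (symbolSeeds_injective D Δ) (image_symbolSeeds D Δ) α β
  obtain ⟨ε', hε', hW'⟩ := seedDet_eq_setDet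
    (symbolSeeds_injective (DurfeeSymbol.ofPartition lam hlam) (DurfeeSymbol.ofPartition mu hmu))
    (image_symbolSeeds _ _) (α + ((-(d₁ + (D.kbar : ℤ)) + δ₁ + (Δ.kbar : ℤ) : ℤ) : ℝ))
    (β + ((-(d₁ + (D.kbar : ℤ) + δ₁ + (Δ.kbar : ℤ)) : ℤ) : ℝ))
  rw [← jacobiPseudoWronskian_eq_seedDet] at hW hW'
  simp only [gaugeFactor, xCount_symbol, yCount_symbol] at hdet
  change (1 - X) ^ gaugeExponent (0 + q) * (1 + X) ^ gaugeExponent 0 * _ = _ at hdet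
  rw [zero_add, show gaugeExponent 0 = 0 from rfl, pow_zero, mul_one] at hdet
  refine ⟨ε * c / ε', div_ne_zero (mul_ne_zero hε hc) hε', fun z hz => ?_⟩
  have hz' : 1 - z ≠ 0 := sub_ne_zero.mpr (Ne.symm hz)
  have e := congrArg (eval z) hdet
  have eW := congrArg (eval z) hW
  have eW' := congrArg (eval z) hW'
  simp only [eval_mul, eval_pow, eval_sub, eval_add, eval_one, eval_X, eval_C] at e eW eW'
  have hexp (u : ℝ) (m n : ℕ) : u ^ (((m : ℤ) + n) * ((m : ℤ) + n - 1))
      = u ^ gaugeExponent (m + n) := by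
    rw [← zpow_natCast, cast_gaugeExponent]
    push_cast
    rfl
  have hexp' : (1 - z) ^ ((δ₁ + (Δ.k : ℤ)) * (δ₁ + (Δ.k : ℤ) - 1))
      = (1 - z) ^ gaugeExponent q := by
    rw [← hδ₁, ← zpow_natCast, cast_gaugeExponent]
  rw [jacobiCanonicalSide, zpow_sub₀ hz', hexp, hexp, hexp', eW, eW']
  have hq : (1 - z) ^ gaugeExponent q ≠ 0 := pow_ne_zero _ hz'
  field_simp
  linear_combination e

/-! ### Degenerate parameters -/

theorem continuous_eval_jacobiP (n : ℕ) {a b : ℝ → ℝ} (ha : Continuous a) (hb : Continuous b)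
    (z : ℝ) : Continuous fun t => (jacobiP n (a t) (b t)).eval z := by
  simp only [jacobiP, eval_finsetSum, eval_mul, eval_C]
  refine continuous_finsetSum _ fun s _ => ?_
  have h1 : Continuous fun t => (ascPochhammer ℝ s).eval ((n : ℝ) + a t + b t + 1) :=
    (Polynomial.continuous _).comp (by fun_prop)
  have h2 : Continuous fun t => (ascPochhammer ℝ (n - s)).eval (a t + (s : ℝ) + 1) :=
    (Polynomial.continuous _).comp (by fun_prop)
  fun_prop

theorem continuous_eval_column (M : ℕ) (s : Seed) (i : ℕ) {a b : ℝ → ℝ} (ha : Continuous a)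
    (hb : Continuous b) (z : ℝ) : Continuous fun t => (s.column M (a t) (b t) i).eval z := by
  rcases s with (n | n) | (n | n)
  · simp only [Seed.column, jacobiEntry]
    split_ifs
    · simp only [eval_mul, eval_C]
      have h1 : Continuous fun t => (ascPochhammer ℝ i).eval ((n : ℝ) + a t + b t + 1) :=
        (Polynomial.continuous _).comp (by fun_prop)
      have h2 := continuous_eval_jacobiP (n - i) (a := fun t => a t + i) (b := fun t => b t + i)
        (by fun_prop) (by fun_prop) z
      fun_prop
    · simpa using continuous_const
  · simp only [Seed.column, jacobiEntryBar, eval_mul, eval_C]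
    have h2 := continuous_eval_jacobiP (n + i) (a := fun t => -a t - i) (b := fun t => -b t - i)
      (by fun_prop) (by fun_prop) z
    fun_prop
  · simp only [Seed.column, jacobiShadowEntry, eval_mul, eval_C]
    have h1 : Continuous fun t => (descPochhammer ℝ i).eval ((n : ℝ) - a t) :=
      (Polynomial.continuous _).comp (by fun_prop)
    have h2 := continuous_eval_jacobiP n (a := fun t => -a t - i) (b := fun t => b t + i)
      (by fun_prop) (by fun_prop) z
    fun_prop
  · simp only [Seed.column, jacobiShadowEntryBar, eval_mul, eval_C]
    have h1 : Continuous fun t => (descPochhammer ℝ i).eval ((n : ℝ) - b t) :=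
      (Polynomial.continuous _).comp (by fun_prop)
    have h2 := continuous_eval_jacobiP n (a := fun t => a t + i) (b := fun t => -b t - i)
      (by fun_prop) (by fun_prop) z
    fun_prop

theorem continuous_eval_jacobiPseudoWronskian (D Δ : DurfeeSymbol) {a b : ℝ → ℝ}
    (ha : Continuous a) (hb : Continuous b) (z : ℝ) :
    Continuous fun t => (jacobiPseudoWronskian D Δ (a t) (b t)).eval z := by
  simp only [jacobiPseudoWronskian_eq_seedDet, eval_seedDet]
  exact Continuous.matrix_det (continuous_matrix fun i j =>
    continuous_eval_column _ _ _ ha hb z)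

/-- The line `t ↦ (α + t, β + 2t)` meets the degenerate parameters in a countable set. -/
theorem dense_nondegenerate (α β : ℝ) :
    Dense {t : ℝ | JacobiNondegenerate (α + t) (β + 2 * t)} := by
  have hc : (⋃ m : ℤ, ({m - α, (m - β) / 2, (m - α - β) / 3, α - β - m} : Set ℝ)).Countable :=
    Set.countable_iUnion fun m => (Set.toFinite _).countable
  refine (hc.dense_compl ℝ).mono fun t ht m => ?_
  simp only [Set.mem_compl_iff, Set.mem_iUnion, Set.mem_insert_iff, Set.mem_singleton_iff,
    not_exists, not_or] at ht
  obtain ⟨h1, h2, h3, h4⟩ := ht m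
  exact ⟨fun e => h1 (by linarith), fun e => h2 (by linarith), fun e => h3 (by linarith),
    fun e => h4 (by linarith)⟩

theorem mainTheorem2 (D Δ : DurfeeSymbol) {p q : ℕ}
    (lam : Fin p → ℕ) (hlam : Antitone lam) (mu : Fin q → ℕ) (hmu : Antitone mu)
    (hD : DurfeeSymbol.SameShapeClass D (DurfeeSymbol.ofPartition lam hlam))
    (hΔ : DurfeeSymbol.SameShapeClass Δ (DurfeeSymbol.ofPartition mu hmu))
    (d₁ δ₁ : ℤ) (hd₁ : (p : ℤ) = d₁ + D.k) (hδ₁ : (q : ℤ) = δ₁ + Δ.k) :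
    (∀ h : 0 < D.kbar, (∀ i, 0 < lam i) → d₁ = D.dbar ⟨0, h⟩) ∧
    (∀ h : 0 < Δ.kbar, (∀ i, 0 < mu i) → δ₁ = Δ.dbar ⟨0, h⟩) ∧
    (∀ α β : ℝ, JacobiNondegenerate α β →
      ∃ c : ℝ, c ≠ 0 ∧ ∀ z : ℝ, z ≠ 1 →
        (jacobiPseudoWronskian D Δ α β).eval z
          = c * jacobiCanonicalSide D Δ lam hlam mu hmu d₁ δ₁ α β z) ∧
    (∀ α β : ℝ,
      ∃ a b : ℝ, (a ≠ 0 ∨ b ≠ 0) ∧ ∀ z : ℝ, z ≠ 1 →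
        a * (jacobiPseudoWronskian D Δ α β).eval z
          = b * jacobiCanonicalSide D Δ lam hlam mu hmu d₁ δ₁ α β z) := by
  have hfirst {E : DurfeeSymbol} {r : ℕ} {nu : Fin r → ℕ} (hnu : Antitone nu)
      (hE : E.SameShapeClass (DurfeeSymbol.ofPartition nu hnu)) {e₁ : ℤ} (he₁ : (r : ℤ) = e₁ + E.k)
      (h : 0 < E.kbar) (hpos : ∀ i, 0 < nu i) : e₁ = E.dbar ⟨0, h⟩ := by
    obtain ⟨s, hs⟩ := hE
    have h1 := DurfeeSymbol.displacement_eq hnu hs h hpos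
    have h2 := E.isIndexSet.charge_eq (DurfeeSymbol.isIndexSet _) hs
    rw [DurfeeSymbol.indexCharge_indexSet, DurfeeSymbol.indexCharge_indexSet] at h2
    change (r : ℤ) - (0 : ℕ) = _ at h2
    push_cast at h2
    linarith
  refine ⟨hfirst hlam hD hd₁, hfirst hmu hΔ hδ₁, fun α β h =>
    exists_eq_mul_canonicalSide hlam hmu hD hΔ hd₁ hδ₁ h, fun α β => ?_⟩
  -- Proportionality is the vanishing of all 2 × 2 minors, a closed condition on the parameters.
  have hminor (z w : ℝ) (hz : z ≠ 1) (hw : w ≠ 1) :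
      (jacobiPseudoWronskian D Δ α β).eval z
          * jacobiCanonicalSide D Δ lam hlam mu hmu d₁ δ₁ α β w
        = (jacobiPseudoWronskian D Δ α β).eval w
          * jacobiCanonicalSide D Δ lam hlam mu hmu d₁ δ₁ α β z := by
    have hP (z : ℝ) : Continuous fun t : ℝ =>
        (jacobiPseudoWronskian D Δ (α + t) (β + 2 * t)).eval z :=
      continuous_eval_jacobiPseudoWronskian D Δ (by fun_prop) (by fun_prop) z
    have hR (z : ℝ) : Continuous fun t : ℝ =>
        jacobiCanonicalSide D Δ lam hlam mu hmu d₁ δ₁ (α + t) (β + 2 * t) z :=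
      continuous_const.mul
        (continuous_eval_jacobiPseudoWronskian _ _ (by fun_prop) (by fun_prop) z)
    have h := Continuous.ext_on (dense_nondegenerate α β) ((hP z).mul (hR w)) ((hP w).mul (hR z))
      fun t ht => by
        obtain ⟨c, -, hc⟩ := exists_eq_mul_canonicalSide hlam hmu hD hΔ hd₁ hδ₁ ht
        simp only [Pi.mul_apply, hc z hz, hc w hw]
        ring
    simpa using congrFun h 0
  by_cases hR : ∃ w : ℝ, w ≠ 1 ∧ jacobiCanonicalSide D Δ lam hlam mu hmu d₁ δ₁ α β w ≠ 0
  · obtain ⟨w, hw, hw0⟩ := hR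
    refine ⟨_, (jacobiPseudoWronskian D Δ α β).eval w, .inl hw0, fun z hz => ?_⟩
    rw [← hminor z w hz hw, mul_comm]
  · push Not at hR
    exact ⟨0, 1, .inr one_ne_zero, fun z hz => by rw [hR z hz]; simp⟩
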